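/- Let $f:\mathbb R\to\mathbb R$ be piecewise smooth: $\mathbb R$ is a disjoint union of finitely many intervals, on each of which $f$ is continuously differentiable and either strictly monotonic or constant. Let $Z,N\sim\mathcal N(0,1)$ be independent and suppose the Shannon entropy $H(\lfloor f(Z)\rfloor)$ is finite. Let $\delta>1$ and let $\lambda$ be a random variable with law $P_\lambda$ supported in a compact interval $[a,b]$, $a>0$, with $\mathbb E[\lambda]=\delta$. For $v\in(0,1]$ put $$\mathsf{mmse}_z(v)=\mathbb E\Big[\big(Z-\mathbb E[Z\mid \sqrt{v^{-1}-1}\,Z+N,\ f(Z)]\big)^2\Big],\qquad \phi(v)=\Big(\tfrac1{\mathsf{mmse}_z(v)}-\tfrac1v\Big)^{-1}\in[0,\infty]$$ (with $1/0=\infty$, $1/\infty=0$), and $\phi(0)=\lim_{v\downarrow0}\phi(v)$. For $V\in[0,\infty]$ put $$\mathsf{MSE}_\lambda(V)=\mathbb E\Big[\tfrac{V}{V+\lambda}\Big],\qquad \Phi(V)=\Big(\tfrac{1}{\frac1\delta\mathbb E[V\lambda/(V+\lambda)]}-\tfrac1V\Big)^{-1},$$ where $\mathsf{MSE}_\lambda(\infty)=1$,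 $\Phi(0)=0$, $\Phi(\infty)=1$. The state evolution of GLM-EP is $V_l^t=\phi(V_r^{t-1})$, $V_r^t=\Phi(V_l^t)$ for $t\ge0$, with $V_r^{-1}=1$. Let $$P(v)=\mathbb E\Big[\tfrac{\phi(v)}{\phi(v)+\lambda}\Big]-\Big[1-\delta\Big(1-\tfrac{\mathsf{mmse}_z(v)}{v}\Big)\Big],\qquad V_r^\star=\inf\{v\in[0,1]: P(u)>0\ \ \forall u\in[v,1]\},$$ with $V_r^\star=1$ if this set is empty, and let the predicted final MSE be $\mathsf{MSE}_\lambda^\star=\mathsf{MSE}_\lambda(\phi(V_r^\star))$. Then: 1. $\mathsf{MSE}^\star_\lambda=\lim_{t\to\infty}\mathsf{MSE}_\lambda(V_l^t)$, and $\mathsf{MSE}^\star_\lambda=0$ if and only if $P(v)>0$ for all $v\in(0,1]$. 2. Suppose moreover that, for Lebesgue-almost every $z$ with $f'(z)=0$, $f$ is constant in a neighbourhood of $z$ (so that $f(Z)$ has a mixed discrete and absolutely continuous law). Then the information dimension $d(f(Z))=\lim_{M\to\infty}H(\lfloor M f(Z)\rfloor/M)/\log M$ exists, and a necessary condition for $P(v)>0$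 for all $v\in(0,1]$ is $\delta\ge 1/d(f(Z))$ (with $1/0=\infty$). So GLM-EP cannot reconstruct perfectly below the information-theoretic threshold $1/d(f(Z))$. -/

import Mathlib

open MeasureTheory ProbabilityTheory Filter Topology Set
open scoped ENNReal

namespace GLMEP

noncomputable section

/-- Shannon entropy (in nats, valued in `[0, ∞]`) of a discrete distribution:
`∑ₐ -p(a) log p(a)` with `p(a) = μ {a}`. -/
def shannonEntropy {α : Type*} [MeasurableSpace α] (μ : Measure α) : ℝ≥0∞ :=
  ∑' a : α, ENNReal.ofReal (Real.negMulLog (μ.real {a}))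

/-- The quantization operator `⟨x⟩_M = ⌊M x⌋ / M`. -/
def quantize (M : ℕ) (x : ℝ) : ℝ := (⌊(M : ℝ) * x⌋ : ℝ) / (M : ℝ)

/-- `d` is the (Rényi) information dimension of the real random variable with law `μ`:
`H(⟨X⟩_M) / log M → d` as `M → ∞`. -/
def HasInformationDimension (μ : Measure ℝ) (d : ℝ≥0∞) : Prop :=
  Tendsto (fun M : ℕ => shannonEntropy (μ.map (quantize M)) / ENNReal.ofReal (Real.log M))
    atTop (𝓝 d)

/-- The conditional MMSE `E[(Z - E[Z | √snr Z + N, U])²]`. -/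
def condMMSE {Ω : Type*} [MeasurableSpace Ω] (μ : Measure Ω) (Z N U : Ω → ℝ) (snr : ℝ) : ℝ :=
  ∫ ω, (Z ω - (μ[Z | MeasurableSpace.comap (fun ω' => (Real.sqrt snr * Z ω' + N ω', U ω'))
    inferInstance]) ω) ^ 2 ∂μ

/-- `mmse_z(v) = mmse(Z, 1/v - 1 | f(Z))` for `v ∈ (0, 1]`, where `Z`, `N` are independent standard
Gaussians, realized as the two coordinates of `ℝ × ℝ`. -/
def mmseZ (f : ℝ → ℝ) (v : ℝ) : ℝ :=
  condMMSE ((gaussianReal 0 1).prod (gaussianReal 0 1))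
    (fun p : ℝ × ℝ => p.1) (fun p => p.2) (fun p => f p.1) (v⁻¹ - 1)

/-- `(1 / mmse_z(v) - 1 / v)⁻¹` in `[0, ∞]`, for `v ∈ (0, 1]`, with `1/0 = ∞` and `1/∞ = 0`
(so the value is `0` if `mmse_z(v) = 0`, and `∞` if `mmse_z(v) = v`). -/
def phiPos (f : ℝ → ℝ) (v : ℝ) : ℝ≥0∞ :=
  ((ENNReal.ofReal (mmseZ f v))⁻¹ - (ENNReal.ofReal v)⁻¹)⁻¹

/-- The state evolution map `φ` on `[0, 1]`, with `φ(0) = lim_{v ↓ 0} φ(v)`. (The limit exists since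
`φ` is nondecreasing on `(0, 1]`.) -/
def phi (f : ℝ → ℝ) (v : ℝ) : ℝ≥0∞ :=
  if v = 0 then limUnder (𝓝[>] (0 : ℝ)) (phiPos f) else phiPos f v

/-- `V / (V + l)` for `V ∈ [0, ∞]` and `l > 0`; its value at `V = ∞` is the limit `1`. -/
def ratio (V : ℝ≥0∞) (l : ℝ) : ℝ :=
  if V = ⊤ then 1 else V.toReal / (V.toReal + l)

/-- `V l / (V + l)` for `V ∈ [0, ∞]` and `l > 0`; its value at `V = ∞` is the limit `l`. -/
def harm (V : ℝ≥0∞) (l : ℝ) : ℝ :=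
  if V = ⊤ then l else V.toReal * l / (V.toReal + l)

/-- `MSE_λ(V) = E[V / (V + λ)]`, where `λ` has law `Pl`. -/
def mse (Pl : Measure ℝ) (V : ℝ≥0∞) : ℝ := ∫ l, ratio V l ∂Pl

/-- The state evolution map `Φ(V) = (1 / ((1/δ) E[V λ / (V + λ)]) - 1 / V)⁻¹` for `V ∈ (0, ∞]`
(with `1 / ∞ = 0`), extended continuously by `Φ(0) = 0`. -/
def Phi (Pl : Measure ℝ) (δ : ℝ) (V : ℝ≥0∞) : ℝ :=
  if V = 0 then 0 else (1 / ((1 / δ) * ∫ l, harm V l ∂Pl) - (V⁻¹).toReal)⁻¹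

/-- The state evolution recursion, started from `V_r^{-1} = 1`. -/
structure IsStateEvolution (f : ℝ → ℝ) (Pl : Measure ℝ) (δ : ℝ)
    (Vl : ℕ → ℝ≥0∞) (Vr : ℕ → ℝ) : Prop where
  left_zero : Vl 0 = phi f 1
  left_succ : ∀ t, Vl (t + 1) = phi f (Vr t)
  right : ∀ t, Vr t = Phi Pl δ (Vl t)

/-- `P(v) = E[φ(v) / (φ(v) + λ)] - [1 - δ (1 - mmse_z(v) / v)]`, for `v ∈ (0, 1]`. -/
def PFun (f : ℝ → ℝ) (Pl : Measure ℝ) (δ : ℝ) (v : ℝ) : ℝ :=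
  mse Pl (phi f v) - (1 - δ * (1 - mmseZ f v / v))

/-- The set `{v ∈ [0, 1] : P(u) > 0 for all u ∈ [v, 1]}`. (Its infimum does not depend on the
value of `P` at `0`.) -/
def goodSet (f : ℝ → ℝ) (Pl : Measure ℝ) (δ : ℝ) : Set ℝ :=
  {v | v ∈ Icc (0 : ℝ) 1 ∧ ∀ u ∈ Icc v 1, 0 < PFun f Pl δ u}

open Classical in
/-- `V_r^⋆ = inf {v ∈ [0, 1] : P(u) > 0 for all u ∈ [v, 1]}`, and `V_r^⋆ = 1` in the degenerate
case where this set is empty. -/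
def VrStar (f : ℝ → ℝ) (Pl : Measure ℝ) (δ : ℝ) : ℝ :=
  if (goodSet f Pl δ).Nonempty then sInf (goodSet f Pl δ) else 1

/-- The predicted final MSE, `MSE_λ^⋆ = MSE_λ(φ(V_r^⋆))`. -/
def finalMSE (f : ℝ → ℝ) (Pl : Measure ℝ) (δ : ℝ) : ℝ :=
  mse Pl (phi f (VrStar f Pl δ))

/-- `f` is piecewise smooth: `ℝ` is a disjoint union of finitely many intervals (points allowed),
on each of which `f` is continuously differentiable and either strictly monotonic or constant. -/
def PiecewiseSmooth (f : ℝ → ℝ) : Prop :=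
  ∃ (K : ℕ) (I : Fin K → Set ℝ),
    (∀ i, (I i).OrdConnected) ∧ Pairwise (fun i j => Disjoint (I i) (I j)) ∧
    (⋃ i, I i) = univ ∧
    ∀ i, ContDiffOn ℝ 1 f (I i) ∧
      (StrictMonoOn f (I i) ∨ StrictAntiOn f (I i) ∨ ∃ c, ∀ x ∈ I i, f x = c)

/-- Up to a Lebesgue-null set, `f'` vanishes only inside the flat sections of `f`. For a piecewise
smooth `f` this says that `f(Z)`, `Z` Gaussian, has a mixed discrete / absolutely continuous law,
the discrete part coming from the flat sections. -/
def CriticalOnlyOnFlat (f : ℝ → ℝ) : Prop :=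
  ∀ᵐ z : ℝ, deriv f z = 0 → ∀ᶠ u in 𝓝 z, f u = f z

end

end GLMEP

/-!
Two noisy looks at a Gaussian signal, of strengths `s` and `Δ`, amount to one look of strength
`s + Δ`; combining an estimator for the first look with the second one gives an error at most
`m / (1 + Δ m)` if the first error is `m`. So the inverse of the minimum mean square error grows at
least as fast as the strength, which makes `φ` nondecreasing. The same inequality for the harmonic
sums `1 / (1 / V + 1 / λ)` makes `Φ` nondecreasing, and `P(v) > 0` says that `T = Φ ∘ φ` satisfies
`T v < v`. Being monotone and right-continuous, `T` iterated from `1` decreases to its largest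
fixed point, which is `V_r^⋆`.

If the iteration decreases to `0`, then `MSE_λ(φ(v)) → 0` as `v → 0`, so that
`δ (1 - mmse_z(v) / v)` is asymptotically at least `1`. On the flat sections of `f` the side
information `f(Z)` does not improve on the error `v` of the noisy look alone, so that
`mmse_z(v) / v` is asymptotically at least their probability. The flat sections only produce atoms
and the remaining law of `f(Z)` is absolutely continuous, so by Rényi's theorem its information
dimension is the probability of the complement of the flat sections.
-/

namespace GLMEP

local notation "γ" => gaussianReal 0 1

/-! ### Harmonic sums as quadratic minima -/

section HarmonicSum

variable {m Δ : ℝ}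

theorem div_one_add_mul_le_quadratic (hm : 0 ≤ m) (hΔ : 0 ≤ Δ) (c : ℝ) :
    m / (1 + Δ * m) ≤ (1 - c * Δ) ^ 2 * m + c ^ 2 * Δ := by
  have hpos : 0 < 1 + Δ * m := by positivity
  have hgap : ((1 - c * Δ) ^ 2 * m + c ^ 2 * Δ) * (1 + Δ * m) - m
      = Δ * (m - c * (1 + Δ * m)) ^ 2 := by ring
  rw [div_le_iff₀ hpos, ← sub_nonneg, hgap]
  positivity

theorem le_div_one_add_mul_of_forall_le_quadratic (hm : 0 ≤ m) (hΔ : 0 ≤ Δ) {x : ℝ}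
    (hx : ∀ c, x ≤ (1 - c * Δ) ^ 2 * m + c ^ 2 * Δ) : x ≤ m / (1 + Δ * m) := by
  refine (hx (m / (1 + Δ * m))).trans_eq ?_
  field_simp
  ring

end HarmonicSum

/-! ### Mean square estimation -/

theorem integral_sub_sq_eq_add_condExp {Ω : Type*} {m mΩ : MeasurableSpace Ω} {μ : Measure Ω}
    [IsFiniteMeasure μ] (hm : m ≤ mΩ) {Z X : Ω → ℝ} (hZ : MemLp Z 2 μ) (hX : MemLp X 2 μ)
    (hXm : StronglyMeasurable[m] X) :
    ∫ ω, (Z ω - X ω) ^ 2 ∂μ =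
      ∫ ω, (Z ω - (μ[Z | m]) ω) ^ 2 ∂μ + ∫ ω, ((μ[Z | m]) ω - X ω) ^ 2 ∂μ := by
  have hsub : μ[Z - X | m] =ᵐ[μ] μ[Z | m] - X := by
    have := condExp_sub (m := m) (hZ.integrable one_le_two) (hX.integrable one_le_two)
    rwa [condExp_of_stronglyMeasurable hm hXm (hX.integrable one_le_two)] at this
  have hvar : ∫ ω, (Var[Z - X; μ | m]) ω ∂μ = ∫ ω, (Z ω - (μ[Z | m]) ω) ^ 2 ∂μ := by
    rw [condVar, integral_condExp hm]
    refine integral_congr_ae ?_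
    filter_upwards [hsub] with ω hω
    simp [hω]
  have hsq : Integrable ((μ[Z - X | m]) ^ 2) μ := ((hZ.sub hX).condExp one_le_two).integrable_sq
  have hmain := integral_congr_ae (condVar_ae_eq_condExp_sq_sub_sq_condExp hm (hZ.sub hX))
  rw [hvar, integral_sub' integrable_condExp hsq, integral_condExp hm,
    integral_congr_ae (hsub.pow_const 2)] at hmain
  rw [hmain]
  simp

theorem lintegral_ofReal_sub_mul_sq {κ : Measure ℝ} [IsFiniteMeasure κ] (hκ : MemLp id 2 κ)
    (hmean : ∫ x, x ∂κ = 0) (c d : ℝ) :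
    ∫⁻ x, ENNReal.ofReal ((c - d * x) ^ 2) ∂κ =
      ENNReal.ofReal (κ.real univ * c ^ 2 + d ^ 2 * ∫ x, x ^ 2 ∂κ) := by
  have hid : Integrable (fun x : ℝ => 2 * c * d * x) κ := (hκ.integrable one_le_two).const_mul _
  have hlin : Integrable (fun x : ℝ => c ^ 2 - 2 * c * d * x) κ := (integrable_const _).sub hid
  have hquad : Integrable (fun x : ℝ => d ^ 2 * x ^ 2) κ := hκ.integrable_sq.const_mul _
  have hexpand : (fun x : ℝ => (c - d * x) ^ 2) =
      fun x => (c ^ 2 - 2 * c * d * x) + d ^ 2 * x ^ 2 := by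
    ext x; ring
  rw [← ofReal_integral_eq_lintegral_ofReal (by rw [hexpand]; exact hlin.add hquad)
    (ae_of_all _ fun _ => sq_nonneg _), hexpand, integral_add hlin hquad,
    integral_sub (integrable_const _) hid, integral_const_mul, integral_const_mul,
    integral_const, hmean]
  simp

theorem integral_sq_gaussianReal : ∫ x, x ^ 2 ∂γ = 1 := by
  have h := variance_fun_id_gaussianReal (μ := 0) (v := 1)
  rw [variance_eq_sub (X := fun x => x) (memLp_id_gaussianReal 2)] at h
  simpa [integral_id_gaussianReal] using h

/-! ### Rotations of a pair of independent Gaussians -/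

theorem measurePreserving_rotate {a b : ℝ} (hab : a ^ 2 + b ^ 2 = 1) :
    MeasurePreserving (fun p : ℝ × ℝ => (a * p.1 - b * p.2, b * p.1 + a * p.2))
      ((γ).prod γ) ((γ).prod γ) := by
  refine ⟨by fun_prop, ?_⟩
  obtain ⟨θ, ha, hb⟩ : ∃ θ : ℝ, a = Real.cos θ ∧ b = Real.sin θ := by
    have hnorm : ‖(⟨a, b⟩ : ℂ)‖ = 1 := by
      rw [Complex.norm_def, Complex.normSq_mk, Real.sqrt_eq_one, ← hab]
      ring
    have hne : (⟨a, b⟩ : ℂ) ≠ 0 := norm_ne_zero_iff.1 (by simp [hnorm])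
    exact ⟨Complex.arg ⟨a, b⟩, by simp [Complex.cos_arg hne, hnorm],
      by simp [Complex.sin_arg, hnorm]⟩
  have hrot := IsGaussian.map_rotation_eq_self (μ := γ) (by simp) (-θ)
  conv_rhs => rw [← hrot]
  congr 1
  ext p
  · simp only [ContinuousLinearMap.rotation_apply, ha, hb, Real.cos_neg, Real.sin_neg, smul_eq_mul]
    ring
  · simp [ContinuousLinearMap.rotation_apply, ha, hb]

theorem lintegral_lintegral_rotate {a b : ℝ} (hab : a ^ 2 + b ^ 2 = 1) {F : ℝ × ℝ → ℝ≥0∞}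
    (hF : Measurable F) :
    ∫⁻ t, ∫⁻ x, F (a * x - b * t, b * x + a * t) ∂γ ∂γ = ∫⁻ n, ∫⁻ n', F (n, n') ∂γ ∂γ := by
  have hrot := measurePreserving_rotate hab
  have hcomp : Measurable fun q : ℝ × ℝ => F (a * q.1 - b * q.2, b * q.1 + a * q.2) :=
    hF.comp hrot.measurable
  rw [← lintegral_prod_symm _ hcomp.aemeasurable, ← lintegral_prod _ hF.aemeasurable]
  exact hrot.lintegral_comp hF

theorem le_lintegral_of_forall_le_lintegral_rotate {α : Type*} [MeasurableSpace α]
    {ρ : Measure α} [SFinite ρ] {a b : ℝ} (hab : a ^ 2 + b ^ 2 = 1)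
    {F : α × ℝ × ℝ → ℝ≥0∞} (hF : Measurable F) {C : ℝ≥0∞}
    (hC : ∀ t, C ≤ ∫⁻ z, ∫⁻ x, F (z, a * x - b * t, b * x + a * t) ∂γ ∂ρ) :
    C ≤ ∫⁻ z, ∫⁻ n, ∫⁻ n', F (z, n, n') ∂γ ∂γ ∂ρ := by
  calc C = ∫⁻ _t, C ∂γ := by simp
    _ ≤ ∫⁻ t, ∫⁻ z, ∫⁻ x, F (z, a * x - b * t, b * x + a * t) ∂γ ∂ρ ∂γ := lintegral_mono hC
    _ = ∫⁻ z, ∫⁻ t, ∫⁻ x, F (z, a * x - b * t, b * x + a * t) ∂γ ∂γ ∂ρ := by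
        refine lintegral_lintegral_swap (Measurable.aemeasurable ?_)
        exact Measurable.lintegral_prod_right' (f := fun q : (ℝ × α) × ℝ =>
          F (q.1.2, a * q.2 - b * q.1.1, b * q.2 + a * q.1.1)) (by fun_prop)
    _ = ∫⁻ z, ∫⁻ n, ∫⁻ n', F (z, n, n') ∂γ ∂γ ∂ρ := lintegral_congr fun z =>
        lintegral_lintegral_rotate hab (F := fun q => F (z, q)) (hF.comp measurable_prodMk_left)

theorem exists_rotation_mul_sqrt_add {s Δ : ℝ} (hs : 0 ≤ s) (hΔ : 0 ≤ Δ) :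
    ∃ a b : ℝ, a ^ 2 + b ^ 2 = 1 ∧ a * √(s + Δ) = √s ∧ b * √(s + Δ) = √Δ := by
  rcases (add_nonneg hs hΔ).eq_or_lt with h0 | hpos
  · obtain ⟨rfl, rfl⟩ := (add_eq_zero_iff_of_nonneg hs hΔ).1 h0.symm
    exact ⟨1, 0, by simp⟩
  · have hsqrt : √(s + Δ) ≠ 0 := (Real.sqrt_pos.2 hpos).ne'
    refine ⟨√s / √(s + Δ), √Δ / √(s + Δ), ?_, div_mul_cancel₀ _ hsqrt, div_mul_cancel₀ _ hsqrt⟩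
    rw [div_pow, div_pow, Real.sq_sqrt hs, Real.sq_sqrt hΔ, Real.sq_sqrt hpos.le, ← add_div,
      div_self hpos.ne']

/-! ### The Gaussian channel with side information -/

/-- The observation `(√s z + n, f z)` of a signal `z` through Gaussian noise `n` at strength `s`,
with side information `f z`. -/
noncomputable def channel (f : ℝ → ℝ) (s : ℝ) (p : ℝ × ℝ) : ℝ × ℝ :=
  (√s * p.1 + p.2, f p.1)

@[fun_prop]
theorem measurable_channel {f : ℝ → ℝ} (hf : Measurable f) (s : ℝ) : Measurable (channel f s) := by
  unfold channel
  fun_prop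

/-- The minimum mean square error for a signal of law `ρ` observed through `channel f s`; the case
of a standard Gaussian signal is `mmseZ`. -/
noncomputable def channelMMSE (ρ : Measure ℝ) (f : ℝ → ℝ) (s : ℝ) : ℝ :=
  condMMSE (ρ.prod γ) (fun p => p.1) (fun p => p.2) (fun p => f p.1) s

theorem mmseZ_eq_channelMMSE (f : ℝ → ℝ) (v : ℝ) : mmseZ f v = channelMMSE γ f (v⁻¹ - 1) :=
  rfl

theorem channelMMSE_nonneg (ρ : Measure ℝ) (f : ℝ → ℝ) (s : ℝ) : 0 ≤ channelMMSE ρ f s :=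
  integral_nonneg fun _ => sq_nonneg _

section Channel

variable {ρ : Measure ℝ} {f : ℝ → ℝ} {s Δ : ℝ}

theorem exists_measurable_condExp_eq_comp_channel (ρ : Measure ℝ) (f : ℝ → ℝ) (s : ℝ) :
    ∃ e : ℝ × ℝ → ℝ, Measurable e ∧
      (ρ.prod γ)[fun p => p.1 | MeasurableSpace.comap (channel f s) inferInstance] =
        e ∘ channel f s := by
  obtain ⟨e, he, heq⟩ := StronglyMeasurable.exists_eq_measurable_comp (f := channel f s)
    (stronglyMeasurable_condExp (f := fun p : ℝ × ℝ => p.1) (μ := ρ.prod γ))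
  exact ⟨e, he.measurable, heq⟩

theorem memLp_fst_prod (hρ : MemLp id 2 ρ) : MemLp (fun p : ℝ × ℝ => p.1) 2 (ρ.prod γ) :=
  hρ.comp_measurePreserving measurePreserving_fst

theorem exists_ofReal_channelMMSE_eq (hρ : MemLp id 2 ρ) (f : ℝ → ℝ) (s : ℝ) :
    ∃ e : ℝ × ℝ → ℝ, Measurable e ∧ ENNReal.ofReal (channelMMSE ρ f s) =
      ∫⁻ p, ENNReal.ofReal ((p.1 - e (channel f s p)) ^ 2) ∂ρ.prod γ := by
  obtain ⟨e, he, heq⟩ := exists_measurable_condExp_eq_comp_channel ρ f s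
  refine ⟨e, he, ?_⟩
  have heL : MemLp (e ∘ channel f s) 2 (ρ.prod γ) :=
    heq ▸ (memLp_fst_prod hρ).condExp one_le_two
  have hint : Integrable (fun p : ℝ × ℝ => (p.1 - e (channel f s p)) ^ 2) (ρ.prod γ) :=
    ((memLp_fst_prod hρ).sub heL).integrable_sq
  rw [← ofReal_integral_eq_lintegral_ofReal hint (ae_of_all _ fun _ => sq_nonneg _)]
  refine congrArg ENNReal.ofReal (integral_congr_ae (ae_of_all _ fun p => ?_))
  exact congrArg (fun x => (p.1 - x) ^ 2) (congrFun heq p)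

variable [IsProbabilityMeasure ρ]

theorem integral_sub_sq_eq_channelMMSE_add (hρ : MemLp id 2 ρ) (hf : Measurable f)
    {g : ℝ × ℝ → ℝ} (hg : Measurable g) (hgL : MemLp (g ∘ channel f s) 2 (ρ.prod γ)) :
    ∫ p, (p.1 - g (channel f s p)) ^ 2 ∂ρ.prod γ = channelMMSE ρ f s +
      ∫ p, (((ρ.prod γ)[fun p => p.1 | MeasurableSpace.comap (channel f s) inferInstance]) p -
        g (channel f s p)) ^ 2 ∂ρ.prod γ :=
  integral_sub_sq_eq_add_condExp (measurable_channel hf s).comap_le (memLp_fst_prod hρ) hgL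
    (hg.comp (comap_measurable (channel f s))).stronglyMeasurable

theorem ofReal_channelMMSE_le (hρ : MemLp id 2 ρ) (hf : Measurable f) (s : ℝ) {g : ℝ × ℝ → ℝ}
    (hg : Measurable g) :
    ENNReal.ofReal (channelMMSE ρ f s) ≤
      ∫⁻ p, ENNReal.ofReal ((p.1 - g (channel f s p)) ^ 2) ∂ρ.prod γ := by
  by_cases htop : ∫⁻ p, ENNReal.ofReal ((p.1 - g (channel f s p)) ^ 2) ∂ρ.prod γ = ⊤
  · exact htop ▸ le_top
  have hint : Integrable (fun p : ℝ × ℝ => (p.1 - g (channel f s p)) ^ 2) (ρ.prod γ) :=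
    (lintegral_ofReal_ne_top_iff_integrable (by fun_prop)
      (ae_of_all _ fun _ => sq_nonneg _)).1 htop
  have herr : MemLp (fun p : ℝ × ℝ => p.1 - g (channel f s p)) 2 (ρ.prod γ) :=
    (memLp_two_iff_integrable_sq (by fun_prop)).2 hint
  have hgL : MemLp (g ∘ channel f s) 2 (ρ.prod γ) := by
    simpa [Pi.sub_def, Function.comp_def] using (memLp_fst_prod hρ).sub herr
  rw [← ofReal_integral_eq_lintegral_ofReal hint (ae_of_all _ fun _ => sq_nonneg _),
    integral_sub_sq_eq_channelMMSE_add hρ hf hg hgL]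
  exact ENNReal.ofReal_le_ofReal (le_add_of_nonneg_right (integral_nonneg fun _ => sq_nonneg _))

-- Rotating the two noises turns one look of strength `s + Δ` and an independent Gaussian `t` into
-- two looks of strengths `s` and `Δ`, so for every `t` the estimator `G` of the two looks is an
-- estimator of the single look; the average over `t` is the error of `G`.
theorem ofReal_channelMMSE_add_le_lintegral (hρ : MemLp id 2 ρ) (hf : Measurable f) (hs : 0 ≤ s)
    (hΔ : 0 ≤ Δ) {G : ℝ × ℝ × ℝ → ℝ} (hG : Measurable G) :
    ENNReal.ofReal (channelMMSE ρ f (s + Δ)) ≤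
      ∫⁻ z, ∫⁻ n, ∫⁻ n', ENNReal.ofReal ((z - G (√s * z + n, √Δ * z + n', f z)) ^ 2)
        ∂γ ∂γ ∂ρ := by
  obtain ⟨a, b, hab, ha, hb⟩ := exists_rotation_mul_sqrt_add hs hΔ
  refine le_lintegral_of_forall_le_lintegral_rotate hab (F := fun q : ℝ × ℝ × ℝ =>
    ENNReal.ofReal ((q.1 - G (√s * q.1 + q.2.1, √Δ * q.1 + q.2.2, f q.1)) ^ 2)) (by fun_prop)
    fun t => ?_
  have hGt : Measurable fun y : ℝ × ℝ => G (a * y.1 - b * t, b * y.1 + a * t, y.2) := by fun_prop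
  refine (ofReal_channelMMSE_le hρ hf (s + Δ) hGt).trans_eq ?_
  rw [lintegral_prod _ (by fun_prop)]
  refine lintegral_congr fun z => lintegral_congr fun x => ?_
  have hfirst : a * (√(s + Δ) * z + x) - b * t = √s * z + (a * x - b * t) := by
    rw [← ha]; ring
  have hsecond : b * (√(s + Δ) * z + x) + a * t = √Δ * z + (b * x + a * t) := by
    rw [← hb]; ring
  simp only [channel, hfirst, hsecond]

theorem channelMMSE_add_le_quadratic (hρ : MemLp id 2 ρ) (hf : Measurable f) (hs : 0 ≤ s)
    (hΔ : 0 ≤ Δ) (c : ℝ) :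
    channelMMSE ρ f (s + Δ) ≤ (1 - c * Δ) ^ 2 * channelMMSE ρ f s + c ^ 2 * Δ := by
  have hm := channelMMSE_nonneg ρ f s
  obtain ⟨e, he, heq⟩ := exists_ofReal_channelMMSE_eq hρ f s
  have herror : ∀ z n n' : ℝ,
      z - ((1 - c * Δ) * e (√s * z + n, f z) + c * √Δ * (√Δ * z + n')) =
        (1 - c * Δ) * (z - e (channel f s (z, n))) - c * √Δ * n' := by
    intro z n n'
    simp only [channel]
    linear_combination (-c * z) * Real.sq_sqrt hΔ
  have hnoise : ∀ z n : ℝ, ∫⁻ n', ENNReal.ofReal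
      (((1 - c * Δ) * (z - e (channel f s (z, n))) - c * √Δ * n') ^ 2) ∂γ =
        ENNReal.ofReal ((1 - c * Δ) ^ 2) * ENNReal.ofReal ((z - e (channel f s (z, n))) ^ 2)
          + ENNReal.ofReal (c ^ 2 * Δ) := by
    intro z n
    rw [lintegral_ofReal_sub_mul_sq (memLp_id_gaussianReal 2) integral_id_gaussianReal,
      integral_sq_gaussianReal, probReal_univ, one_mul, mul_one,
      ENNReal.ofReal_add (sq_nonneg _) (sq_nonneg _), mul_pow, mul_pow, Real.sq_sqrt hΔ,
      ENNReal.ofReal_mul (sq_nonneg _)]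
  rw [← ENNReal.ofReal_le_ofReal_iff (by positivity), ENNReal.ofReal_add (by positivity)
    (by positivity), ENNReal.ofReal_mul (sq_nonneg _)]
  calc ENNReal.ofReal (channelMMSE ρ f (s + Δ))
      ≤ ∫⁻ z, ∫⁻ n, ∫⁻ n', ENNReal.ofReal
          ((z - ((1 - c * Δ) * e (√s * z + n, f z) + c * √Δ * (√Δ * z + n'))) ^ 2) ∂γ ∂γ ∂ρ :=
        ofReal_channelMMSE_add_le_lintegral hρ hf hs hΔ
          (G := fun y => (1 - c * Δ) * e (y.1, y.2.2) + c * √Δ * y.2.1) (by fun_prop)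
    _ = ∫⁻ p, (ENNReal.ofReal ((1 - c * Δ) ^ 2) *
          ENNReal.ofReal ((p.1 - e (channel f s p)) ^ 2) + ENNReal.ofReal (c ^ 2 * Δ))
          ∂ρ.prod γ := by
        simp only [herror, hnoise]
        rw [lintegral_prod _ (by fun_prop)]
    _ = ENNReal.ofReal ((1 - c * Δ) ^ 2) * ENNReal.ofReal (channelMMSE ρ f s)
          + ENNReal.ofReal (c ^ 2 * Δ) := by
        rw [lintegral_add_right _ measurable_const, lintegral_const_mul _ (by fun_prop), ← heq,
          lintegral_const, measure_univ, mul_one]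

theorem channelMMSE_add_le_div (hρ : MemLp id 2 ρ) (hf : Measurable f) (hs : 0 ≤ s)
    (hΔ : 0 ≤ Δ) :
    channelMMSE ρ f (s + Δ) ≤ channelMMSE ρ f s / (1 + Δ * channelMMSE ρ f s) :=
  le_div_one_add_mul_of_forall_le_quadratic (channelMMSE_nonneg ρ f s) hΔ
    (channelMMSE_add_le_quadratic hρ hf hs hΔ)

theorem inv_channelMMSE_add_le (hρ : MemLp id 2 ρ) (hf : Measurable f) (hs : 0 ≤ s)
    (hΔ : 0 ≤ Δ) :
    (ENNReal.ofReal (channelMMSE ρ f s))⁻¹ + ENNReal.ofReal Δ ≤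
      (ENNReal.ofReal (channelMMSE ρ f (s + Δ)))⁻¹ := by
  have hle := channelMMSE_add_le_div hρ hf hs hΔ
  rcases (channelMMSE_nonneg ρ f (s + Δ)).eq_or_lt with hzero | hpos
  · simp [← hzero]
  have hm : 0 < channelMMSE ρ f s := (channelMMSE_nonneg ρ f s).lt_of_ne fun h0 => by
    rw [← h0, zero_div] at hle
    exact hle.not_gt hpos
  rw [← ENNReal.ofReal_inv_of_pos hm, ← ENNReal.ofReal_inv_of_pos hpos,
    ← ENNReal.ofReal_add (by positivity) hΔ]
  refine ENNReal.ofReal_le_ofReal ?_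
  rw [le_inv_comm₀ (by positivity) hpos]
  refine hle.trans_eq ?_
  field_simp

theorem channelMMSE_zero_le_integral_sq (hρ : MemLp id 2 ρ) (hf : Measurable f) :
    channelMMSE ρ f 0 ≤ ∫ z, z ^ 2 ∂ρ := by
  have hint : Integrable (fun z : ℝ => z ^ 2) ρ := hρ.integrable_sq
  have hle := ofReal_channelMMSE_le hρ hf 0 (g := fun _ => 0) measurable_const
  have hvar := lintegral_prod (μ := ρ) (ν := γ) (fun p : ℝ × ℝ => ENNReal.ofReal ((p.1 - 0) ^ 2))
    (by fun_prop)
  simp only [sub_zero, lintegral_const, measure_univ, mul_one] at hle hvar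
  rwa [hvar, ← ofReal_integral_eq_lintegral_ofReal hint
    (ae_of_all _ fun _ => sq_nonneg _), ENNReal.ofReal_le_ofReal_iff
    (integral_nonneg fun _ => sq_nonneg _)] at hle

theorem continuous_integral_sub_boundedContinuous_channel_sq (hρ : MemLp id 2 ρ)
    (hf : Measurable f) (h : BoundedContinuousFunction (ℝ × ℝ) ℝ) :
    Continuous fun s => ∫ p, (p.1 - h (channel f s p)) ^ 2 ∂ρ.prod γ := by
  refine continuous_of_dominated (bound := fun p => 2 * (p.1 ^ 2 + ‖h‖ ^ 2))
    (fun s => ?_) (fun s => ae_of_all _ fun p => ?_)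
    (((memLp_fst_prod hρ).integrable_sq.add (integrable_const _)).const_mul 2)
    (ae_of_all _ fun p => ?_)
  · have := h.continuous.measurable
    exact Measurable.aestronglyMeasurable (by fun_prop)
  · have hbound : h (channel f s p) ^ 2 ≤ ‖h‖ ^ 2 := by
      simpa using pow_le_pow_left₀ (norm_nonneg _) (h.norm_coe_le_norm (channel f s p)) 2
    rw [Real.norm_of_nonneg (sq_nonneg _)]
    nlinarith [sq_nonneg (p.1 + h (channel f s p))]
  · simp only [channel]
    fun_prop

theorem memLp_boundedContinuous_comp_channel (ρ : Measure ℝ) [IsProbabilityMeasure ρ]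
    (hf : Measurable f) (s : ℝ) (h : BoundedContinuousFunction (ℝ × ℝ) ℝ) :
    MemLp (h ∘ channel f s) 2 (ρ.prod γ) :=
  MemLp.of_bound (h.continuous.measurable.comp (measurable_channel hf s)).aestronglyMeasurable
    ‖h‖ (ae_of_all _ fun _ => h.norm_coe_le_norm _)

theorem exists_boundedContinuous_integral_sub_sq_lt (hρ : MemLp id 2 ρ) (hf : Measurable f)
    (s : ℝ) {y : ℝ} (hy : channelMMSE ρ f s < y) :
    ∃ h : BoundedContinuousFunction (ℝ × ℝ) ℝ,
      ∫ p, (p.1 - h (channel f s p)) ^ 2 ∂ρ.prod γ < y := by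
  obtain ⟨e, he, heq⟩ := exists_measurable_condExp_eq_comp_channel ρ f s
  have hch := measurable_channel hf s
  have heL : MemLp e (ENNReal.ofReal 2) ((ρ.prod γ).map (channel f s)) := by
    rw [memLp_map_measure_iff he.aestronglyMeasurable hch.aemeasurable, ← heq]
    simpa using (memLp_fst_prod hρ).condExp one_le_two
  obtain ⟨ε, hε, hεy⟩ := exists_between (sub_pos.2 hy)
  obtain ⟨h, hclose, -⟩ := heL.exists_boundedContinuous_integral_rpow_sub_le two_pos hε
  refine ⟨h, ?_⟩
  have hh := h.continuous.measurable
  rw [integral_map hch.aemeasurable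
    (by exact ((he.sub hh).norm.pow_const _).aestronglyMeasurable)] at hclose
  rw [integral_sub_sq_eq_channelMMSE_add hρ hf hh
    (memLp_boundedContinuous_comp_channel ρ hf s h), heq]
  simp only [Real.rpow_ofNat, Real.norm_eq_abs, sq_abs] at hclose
  simp only [Function.comp_apply]
  linarith

theorem upperSemicontinuous_channelMMSE (hρ : MemLp id 2 ρ) (hf : Measurable f) :
    UpperSemicontinuous (channelMMSE ρ f) := by
  intro s y hy
  obtain ⟨h, hlt⟩ := exists_boundedContinuous_integral_sub_sq_lt hρ hf s hy
  have hcont := continuous_integral_sub_boundedContinuous_channel_sq hρ hf h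
  filter_upwards [hcont.tendsto s |>.eventually (gt_mem_nhds hlt)] with t ht
  rw [integral_sub_sq_eq_channelMMSE_add hρ hf h.continuous.measurable
    (memLp_boundedContinuous_comp_channel ρ hf t h)] at ht
  exact (le_add_of_nonneg_right (integral_nonneg fun _ => sq_nonneg _)).trans_lt ht

end Channel

/-! ### Flat sections -/

/-- The flat sections of `f`: the points around which `f` is locally constant. -/
def flatSet {X Y : Type*} [TopologicalSpace X] (f : X → Y) : Set X :=
  {z | ∀ᶠ u in 𝓝 z, f u = f z}

theorem isOpen_flatSet {X Y : Type*} [TopologicalSpace X] (f : X → Y) : IsOpen (flatSet f) := by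
  refine isOpen_iff_mem_nhds.2 fun z (hz : ∀ᶠ u in 𝓝 z, f u = f z) => ?_
  filter_upwards [hz.eventually_nhds] with u hu
  filter_upwards [hu] with w hw
  rw [hw, hu.self_of_nhds]

theorem apply_eq_of_isPreconnected_subset_flatSet {X Y : Type*} [TopologicalSpace X] {f : X → Y}
    {s : Set X} (hs : IsPreconnected s) (hsub : s ⊆ flatSet f) {x y : X} (hx : x ∈ s)
    (hy : y ∈ s) : f x = f y := by
  have : PreconnectedSpace s := isPreconnected_iff_preconnectedSpace.1 hs
  have hconst : IsLocallyConstant (s.domRestrict f) := (IsLocallyConstant.iff_eventually_eq _).2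
    fun z => continuous_subtype_val.continuousAt.eventually (hsub z.2)
  exact hconst.apply_eq_of_preconnectedSpace ⟨x, hx⟩ ⟨y, hy⟩

theorem countable_image_flatSet {X Y : Type*} [TopologicalSpace X]
    [TopologicalSpace.SeparableSpace X] (f : X → Y) : (f '' flatSet f).Countable := by
  refine Set.PairwiseDisjoint.countable_of_isOpen (s := fun y => interior (f ⁻¹' {y}))
    (fun y _ y' _ hne => ?_) (fun _ _ => isOpen_interior) ?_
  · exact ((disjoint_singleton.2 hne).preimage f).mono interior_subset interior_subset
  · rintro _ ⟨z, hz, rfl⟩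
    exact ⟨z, mem_interior_iff_mem_nhds.2 hz⟩

theorem exists_forall_abs_sub_lt_imp_eq_of_isCompact {f : ℝ → ℝ} {K : Set ℝ} (hK : IsCompact K)
    (hsub : K ⊆ flatSet f) : ∃ η > 0, ∀ y ∈ K, ∀ u, |u - y| < η → f u = f y := by
  obtain ⟨η, hη, hthick⟩ := hK.exists_thickening_subset_open (isOpen_flatSet f) hsub
  exact ⟨η, hη, fun y hy u hu => apply_eq_of_isPreconnected_subset_flatSet
    (convex_ball y η).isPreconnected ((Metric.ball_subset_thickening hy η).trans hthick)
    hu (Metric.mem_ball_self hη)⟩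

theorem exists_isCompact_subset_lt_measureReal {μ : Measure ℝ} [IsFiniteMeasure μ] {U : Set ℝ}
    (hU : IsOpen U) {c : ℝ} (hc : 0 ≤ c) (hcU : c < μ.real U) :
    ∃ K ⊆ U, IsCompact K ∧ c < μ.real K := by
  obtain ⟨K, hKU, hK, hlt⟩ := hU.exists_lt_isCompact
    ((ENNReal.ofReal_lt_iff_lt_toReal hc (measure_ne_top μ U)).2 hcU)
  exact ⟨K, hKU, hK, (ENNReal.ofReal_lt_iff_lt_toReal hc (measure_ne_top μ K)).1 hlt⟩

/-- The second moment of a standard Gaussian truncated to `[-R, R]`. -/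
noncomputable def truncatedMoment (R : ℝ) : ℝ :=
  ∫ x in Icc (-R) R, x ^ 2 ∂γ

theorem truncatedMoment_nonneg (R : ℝ) : 0 ≤ truncatedMoment R :=
  integral_nonneg fun _ => sq_nonneg _

theorem tendsto_truncatedMoment : Tendsto truncatedMoment atTop (𝓝 1) := by
  have hcover := (aecover_Icc (μ := γ) tendsto_neg_atTop_atBot
    tendsto_id).integral_tendsto_of_countably_generated (memLp_id_gaussianReal 2).integrable_sq
  simp only [id_eq, integral_sq_gaussianReal] at hcover
  exact hcover

theorem setIntegral_id_symmetric_gaussianReal (R : ℝ) : ∫ x in Icc (-R) R, x ∂γ = 0 := by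
  have hneg : MeasurePreserving (fun x : ℝ => -x) γ γ :=
    ⟨measurable_neg, by rw [gaussianReal_map_neg, neg_zero]⟩
  have hsymm := hneg.setIntegral_preimage_emb (Homeomorph.neg ℝ).measurableEmbedding (fun x => x)
    (Icc (-R) R)
  have hpre : (fun x : ℝ => -x) ⁻¹' Icc (-R) R = Icc (-R) R := by simp
  rw [hpre, integral_neg] at hsymm
  linarith

theorem ofReal_mul_truncatedMoment_le (R b t : ℝ) :
    ENNReal.ofReal (b ^ 2 * truncatedMoment R) ≤
      ∫⁻ w in Icc (-R) R, ENNReal.ofReal ((t - b * w) ^ 2) ∂γ := by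
  rw [lintegral_ofReal_sub_mul_sq ((memLp_id_gaussianReal 2).restrict _)
    (setIntegral_id_symmetric_gaussianReal R)]
  exact ENNReal.ofReal_le_ofReal (le_add_of_nonneg_left (by positivity))

-- In rotated coordinates `z = a y - b w`, `n = b y + a w` the observation through the noise is
-- `y / b`. While `y ∈ K` and `|w| ≤ R` the side information is `f y`, so that `w` is unobserved.
theorem mul_measureReal_le_channelMMSE_of_flat {f : ℝ → ℝ} (hf : Measurable f) {K : Set ℝ}
    (hK : MeasurableSet K) {a b R : ℝ} (ha : 0 ≤ a) (hb : 0 < b) (hab : a ^ 2 + b ^ 2 = 1)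
    (hflat : ∀ y ∈ K, ∀ w ∈ Icc (-R) R, f (a * y - b * w) = f y) :
    b ^ 2 * truncatedMoment R * (γ).real K ≤ channelMMSE γ f ((b ^ 2)⁻¹ - 1) := by
  have hsqrt : √((b ^ 2)⁻¹ - 1) = a / b := by
    rw [← Real.sqrt_sq (div_nonneg ha hb.le), div_pow]
    congr 1
    field_simp
    linarith
  have hobs : ∀ y ∈ K, ∀ w ∈ Icc (-R) R,
      channel f ((b ^ 2)⁻¹ - 1) (a * y - b * w, b * y + a * w) = (y / b, f y) := by
    intro y hy w hw
    simp only [channel, hsqrt, hflat y hy w hw]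
    refine Prod.ext ?_ rfl
    field_simp
    linear_combination y * hab
  have hrot := measurePreserving_rotate hab
  have hT := truncatedMoment_nonneg R
  obtain ⟨e, he, heq⟩ := exists_ofReal_channelMMSE_eq (memLp_id_gaussianReal 2) f ((b ^ 2)⁻¹ - 1)
  have herr : Measurable fun p : ℝ × ℝ =>
      ENNReal.ofReal ((p.1 - e (channel f ((b ^ 2)⁻¹ - 1) p)) ^ 2) := by fun_prop
  rw [← hrot.lintegral_comp herr,
    lintegral_prod _ (by exact (herr.comp hrot.measurable).aemeasurable)] at heq
  rw [← ENNReal.ofReal_le_ofReal_iff (channelMMSE_nonneg _ _ _), heq,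
    ENNReal.ofReal_mul (by positivity), ofReal_measureReal, ← setLIntegral_const]
  refine (setLIntegral_mono' hK fun y hy => ?_).trans (setLIntegral_le_lintegral K _)
  refine ((ofReal_mul_truncatedMoment_le R b (a * y - e (y / b, f y))).trans_eq ?_).trans
    (setLIntegral_le_lintegral (Icc (-R) R) _)
  refine setLIntegral_congr_fun measurableSet_Icc fun w hw => ?_
  simp only [hobs y hy w hw]
  congr 2
  ring

theorem eventually_forall_apply_rotate_eq {f : ℝ → ℝ} {K : Set ℝ} (hK : IsCompact K)
    (hsub : K ⊆ flatSet f) (R : ℝ) :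
    ∀ᶠ v in 𝓝 (0 : ℝ), ∀ y ∈ K, ∀ w ∈ Icc (-R) R, f (√(1 - v) * y - √v * w) = f y := by
  obtain ⟨η, hη, hflat⟩ := exists_forall_abs_sub_lt_imp_eq_of_isCompact hK hsub
  obtain ⟨B, hB⟩ := hK.isBounded.exists_norm_le
  have hlim : Tendsto (fun v : ℝ => |√(1 - v) - 1| * B + √v * R) (𝓝 0) (𝓝 0) := by
    have hcont : Continuous fun v : ℝ => |√(1 - v) - 1| * B + √v * R := by fun_prop
    simpa using hcont.tendsto 0
  filter_upwards [hlim.eventually (gt_mem_nhds hη)] with v hv y hy w hw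
  refine hflat y hy _ (lt_of_le_of_lt ?_ hv)
  calc |√(1 - v) * y - √v * w - y| = |(√(1 - v) - 1) * y - √v * w| := by ring_nf
    _ ≤ |√(1 - v) - 1| * |y| + √v * |w| := by
        refine (abs_sub _ _).trans_eq ?_
        rw [abs_mul, abs_mul, abs_of_nonneg (Real.sqrt_nonneg v)]
    _ ≤ |√(1 - v) - 1| * B + √v * R := by
        gcongr
        exacts [hB y hy, abs_le.2 hw]

theorem eventually_mul_le_mmseZ {f : ℝ → ℝ} (hf : Measurable f) {c : ℝ}
    (hc : c < (γ).real (flatSet f)) : ∀ᶠ v in 𝓝[>] (0 : ℝ), c * v ≤ mmseZ f v := by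
  rcases lt_or_ge c 0 with hneg | hnonneg
  · filter_upwards [self_mem_nhdsWithin] with v (hv : 0 < v)
    exact (mul_nonpos_of_nonpos_of_nonneg hneg.le hv.le).trans (channelMMSE_nonneg _ _ _)
  obtain ⟨K, hKsub, hK, hcK⟩ := exists_isCompact_subset_lt_measureReal (isOpen_flatSet f) hnonneg hc
  obtain ⟨R, hR⟩ : ∃ R, c < truncatedMoment R * (γ).real K :=
    ((tendsto_truncatedMoment.mul_const _).eventually
      (lt_mem_nhds (by rwa [one_mul]))).exists
  filter_upwards [nhdsWithin_le_nhds (eventually_forall_apply_rotate_eq hK hKsub R),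
    self_mem_nhdsWithin, nhdsWithin_le_nhds (gt_mem_nhds (zero_lt_one (α := ℝ)))]
    with v hflat (hv : 0 < v) hv1
  have hsq : √v ^ 2 = v := Real.sq_sqrt hv.le
  have hsq' : √(1 - v) ^ 2 = 1 - v := Real.sq_sqrt (by linarith)
  have hle := mul_measureReal_le_channelMMSE_of_flat hf hK.measurableSet (Real.sqrt_nonneg (1 - v))
    (Real.sqrt_pos.2 hv) (by rw [hsq, hsq']; ring) hflat
  rw [hsq, ← mmseZ_eq_channelMMSE] at hle
  calc c * v ≤ truncatedMoment R * (γ).real K * v := by gcongr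
    _ = v * truncatedMoment R * (γ).real K := by ring
    _ ≤ mmseZ f v := hle

/-! ### The state evolution map `φ` -/

theorem channelMMSE_anti {ρ : Measure ℝ} [IsProbabilityMeasure ρ] (hρ : MemLp id 2 ρ) {f : ℝ → ℝ}
    (hf : Measurable f) {s t : ℝ} (hs : 0 ≤ s) (hst : s ≤ t) :
    channelMMSE ρ f t ≤ channelMMSE ρ f s := by
  have hm := channelMMSE_nonneg ρ f s
  have hΔ := sub_nonneg.2 hst
  have hle := channelMMSE_add_le_div hρ hf hs hΔ
  rw [add_sub_cancel] at hle
  exact hle.trans (div_le_self hm (le_add_of_nonneg_right (by positivity)))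

theorem inv_ofReal_eq_add {v w : ℝ} (hv : 0 < v) (hvw : v ≤ w) :
    (ENNReal.ofReal v)⁻¹ = (ENNReal.ofReal w)⁻¹ + ENNReal.ofReal (v⁻¹ - w⁻¹) := by
  have hw := hv.trans_le hvw
  rw [← ENNReal.ofReal_inv_of_pos hv, ← ENNReal.ofReal_inv_of_pos hw,
    ← ENNReal.ofReal_add (by positivity) (sub_nonneg.2 (inv_anti₀ hv hvw)), add_sub_cancel]

theorem phi_of_pos {f : ℝ → ℝ} {v : ℝ} (hv : 0 < v) : phi f v = phiPos f v :=
  if_neg hv.ne'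

theorem phi_eq_zero_iff {f : ℝ → ℝ} {v : ℝ} (hv : 0 < v) : phi f v = 0 ↔ mmseZ f v = 0 := by
  simp only [phi_of_pos hv, phiPos, ENNReal.inv_eq_zero, ENNReal.sub_eq_top_iff, ne_eq,
    ENNReal.inv_eq_top, ENNReal.ofReal_eq_zero, not_le, hv, and_true]
  exact (channelMMSE_nonneg _ _ _).ge_iff_eq'

section Phi

variable {f : ℝ → ℝ} (hf : Measurable f) {v w : ℝ}
include hf

theorem inv_ofReal_mmseZ_add_le (hv : 0 < v) (hvw : v ≤ w) (hw : w ≤ 1) :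
    (ENNReal.ofReal (mmseZ f w))⁻¹ + ENNReal.ofReal (v⁻¹ - w⁻¹) ≤
      (ENNReal.ofReal (mmseZ f v))⁻¹ := by
  have hle := inv_channelMMSE_add_le (memLp_id_gaussianReal (μ := 0) (v := 1) 2) hf
    (sub_nonneg.2 (one_le_inv_iff₀.2 ⟨hv.trans_le hvw, hw⟩)) (sub_nonneg.2 (inv_anti₀ hv hvw))
  rwa [show w⁻¹ - 1 + (v⁻¹ - w⁻¹) = v⁻¹ - 1 by ring] at hle

theorem mmseZ_le_self (hv : v ∈ Ioc (0 : ℝ) 1) : mmseZ f v ≤ v := by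
  have hone : mmseZ f 1 ≤ 1 := by
    rw [mmseZ_eq_channelMMSE, inv_one, sub_self]
    exact (channelMMSE_zero_le_integral_sq (memLp_id_gaussianReal 2) hf).trans_eq
      integral_sq_gaussianReal
  rw [← ENNReal.ofReal_le_ofReal_iff hv.1.le, ← ENNReal.inv_le_inv, inv_ofReal_eq_add hv.1 hv.2]
  exact (add_le_add_left (ENNReal.inv_le_inv.2 (ENNReal.ofReal_le_ofReal hone)) _).trans
    (inv_ofReal_mmseZ_add_le hf hv.1 hv.2 le_rfl)

theorem phiPos_monotoneOn : MonotoneOn (phiPos f) (Ioc (0 : ℝ) 1) := by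
  intro v hv w hw hvw
  refine ENNReal.inv_le_inv.2 ?_
  calc (ENNReal.ofReal (mmseZ f w))⁻¹ - (ENNReal.ofReal w)⁻¹
      = ((ENNReal.ofReal (mmseZ f w))⁻¹ + ENNReal.ofReal (v⁻¹ - w⁻¹)) - (ENNReal.ofReal v)⁻¹ := by
        rw [inv_ofReal_eq_add hv.1 hvw, ENNReal.add_sub_add_eq_sub_right ENNReal.ofReal_ne_top]
    _ ≤ (ENNReal.ofReal (mmseZ f v))⁻¹ - (ENNReal.ofReal v)⁻¹ :=
        tsub_le_tsub_right (inv_ofReal_mmseZ_add_le hf hv.1 hvw hw.2) _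

theorem tendsto_phiPos_nhdsGT_zero : Tendsto (phiPos f) (𝓝[>] 0) (𝓝 (phi f 0)) := by
  have hlim := MonotoneOn.tendsto_nhdsWithin_Ioo_right (nonempty_Ioo.2 zero_lt_one)
    ((phiPos_monotoneOn hf).mono Ioo_subset_Ioc_self) (OrderBot.bddBelow _)
  rwa [phi, if_pos rfl, hlim.limUnder_eq]

theorem phi_monotoneOn : MonotoneOn (phi f) (Icc (0 : ℝ) 1) := by
  have hpos : ∀ {v w : ℝ}, 0 < v → v ≤ w → w ≤ 1 → phiPos f v ≤ phi f w := fun hv hvw hw => by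
    rw [phi_of_pos (hv.trans_le hvw)]
    exact phiPos_monotoneOn hf ⟨hv, hvw.trans hw⟩ ⟨hv.trans_le hvw, hw⟩ hvw
  intro v hv w hw hvw
  rcases hv.1.eq_or_lt with rfl | hv0
  · rcases hw.1.eq_or_lt with rfl | hw0
    · exact le_rfl
    refine le_of_tendsto (tendsto_phiPos_nhdsGT_zero hf) ?_
    filter_upwards [Ioo_mem_nhdsGT hw0] with u hu
    exact hpos hu.1 hu.2.le hw.2
  · exact (phi_of_pos hv0).trans_le (hpos hv0 hvw hw.2)

-- The mean square error is nondecreasing in `v`, so that its right-continuity follows from upper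
-- semicontinuity.
theorem continuousWithinAt_mmseZ (hv : v ∈ Ioc (0 : ℝ) 1) :
    ContinuousWithinAt (mmseZ f) (Icc v 1) v := by
  have hγ : MemLp id 2 γ := memLp_id_gaussianReal 2
  have hinv : Tendsto (fun w : ℝ => w⁻¹ - 1) (𝓝[Icc v 1] v) (𝓝 (v⁻¹ - 1)) :=
    ((tendsto_inv₀ hv.1.ne').sub_const 1).mono_left nhdsWithin_le_nhds
  refine tendsto_order.2 ⟨fun l hl => ?_, fun u hu =>
    hinv.eventually (upperSemicontinuous_channelMMSE hγ hf _ u hu)⟩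
  filter_upwards [self_mem_nhdsWithin] with w hw
  exact hl.trans_le (channelMMSE_anti hγ hf
    (sub_nonneg.2 (one_le_inv_iff₀.2 ⟨hv.1.trans_le hw.1, hw.2⟩))
    (sub_le_sub_right (inv_anti₀ hv.1 hw.1) 1))

theorem continuousWithinAt_phi (hv : v ∈ Icc (0 : ℝ) 1) :
    ContinuousWithinAt (phi f) (Icc v 1) v := by
  rcases hv.1.eq_or_lt with rfl | hv0
  · have hright : ContinuousWithinAt (phi f) (Ioi 0) 0 := by
      refine (tendsto_phiPos_nhdsGT_zero hf).congr' ?_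
      filter_upwards [self_mem_nhdsWithin] with w hw using (phi_of_pos hw).symm
    exact (continuousWithinAt_Ioi_iff_Ici.1 hright).mono Icc_subset_Ici_self
  · have hphiPos : ContinuousWithinAt (phiPos f) (Icc v 1) v := by
      have hmmse := (ENNReal.continuous_ofReal.tendsto _).comp
        (continuousWithinAt_mmseZ hf ⟨hv0, hv.2⟩)
      have hself : Tendsto (fun w : ℝ => (ENNReal.ofReal w)⁻¹) (𝓝[Icc v 1] v)
          (𝓝 (ENNReal.ofReal v)⁻¹) :=
        ((continuous_inv.comp ENNReal.continuous_ofReal).tendsto v).mono_left nhdsWithin_le_nhds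
      exact (ENNReal.Tendsto.sub hmmse.inv hself (Or.inr (by simpa using hv0))).inv
    exact hphiPos.congr (fun w hw => phi_of_pos (hv0.trans_le hw.1)) (phi_of_pos hv0)

theorem toReal_inv_phi (hv : v ∈ Ioc (0 : ℝ) 1) (hm : 0 < mmseZ f v) :
    ((phi f v)⁻¹).toReal = (mmseZ f v)⁻¹ - v⁻¹ := by
  rw [phi_of_pos hv.1, phiPos, inv_inv, ENNReal.toReal_sub_of_le
    (ENNReal.inv_le_inv.2 (ENNReal.ofReal_le_ofReal (mmseZ_le_self hf hv))) (by simpa using hm),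
    ENNReal.toReal_inv, ENNReal.toReal_inv, ENNReal.toReal_ofReal hm.le,
    ENNReal.toReal_ofReal hv.1.le]

end Phi

/-! ### The maps `MSE_λ` and `Φ` -/

section Ratio

variable {V : ℝ≥0∞} {l : ℝ}

theorem ratio_eq_one_div (hV : V ≠ 0) (hl : 0 < l) : ratio V l = 1 / (1 + (V⁻¹).toReal * l) := by
  unfold ratio
  split_ifs with hV'
  · simp [hV']
  · have hpos := ENNReal.toReal_pos hV hV'
    rw [ENNReal.toReal_inv]
    field_simp

theorem ratio_nonneg (V : ℝ≥0∞) (hl : 0 < l) : 0 ≤ ratio V l := by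
  unfold ratio
  split_ifs <;> positivity

theorem ratio_pos (hV : V ≠ 0) (hl : 0 < l) : 0 < ratio V l := by
  rw [ratio_eq_one_div hV hl]
  positivity

theorem ratio_le_one (V : ℝ≥0∞) (hl : 0 < l) : ratio V l ≤ 1 := by
  unfold ratio
  split_ifs
  · exact le_rfl
  · exact div_le_one_of_le₀ (by linarith) (by positivity)

theorem measurable_ratio (V : ℝ≥0∞) : Measurable (ratio V) := by
  unfold ratio
  split_ifs <;> fun_prop

theorem continuous_ratio (hl : 0 < l) : Continuous fun V => ratio V l := by
  have heq : (fun V => ratio V l) = fun V => ((1 + ENNReal.ofReal l * V⁻¹)⁻¹).toReal := by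
    ext V
    rcases eq_or_ne V 0 with rfl | hV
    · simp [ratio, ENNReal.mul_top, hl]
    · rw [ratio_eq_one_div hV hl, one_div, ENNReal.toReal_inv (1 + _),
        ENNReal.toReal_add ENNReal.one_ne_top
          (ENNReal.mul_ne_top ENNReal.ofReal_ne_top (ENNReal.inv_ne_top.2 hV)),
        ENNReal.toReal_mul, ENNReal.toReal_ofReal hl.le, ENNReal.toReal_one, mul_comm l]
  have hcont : Continuous fun V : ℝ≥0∞ => (1 + ENNReal.ofReal l * V⁻¹)⁻¹ :=
    (continuous_const.add
      ((ENNReal.continuous_const_mul ENNReal.ofReal_ne_top).comp continuous_inv)).inv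
  rw [heq]
  exact ENNReal.continuousOn_toReal.comp_continuous hcont fun V => ENNReal.inv_ne_top.2 (by simp)

theorem harm_eq_mul_ratio (V : ℝ≥0∞) (l : ℝ) : harm V l = l * ratio V l := by
  unfold harm ratio
  split_ifs <;> ring

theorem harm_nonneg (V : ℝ≥0∞) (hl : 0 < l) : 0 ≤ harm V l := by
  rw [harm_eq_mul_ratio]
  exact mul_nonneg hl.le (ratio_nonneg V hl)

theorem harm_le (V : ℝ≥0∞) (hl : 0 < l) : harm V l ≤ l := by
  rw [harm_eq_mul_ratio]
  exact mul_le_of_le_one_right hl.le (ratio_le_one V hl)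

theorem measurable_harm (V : ℝ≥0∞) : Measurable (harm V) := by
  rw [funext (harm_eq_mul_ratio V)]
  exact measurable_id.mul (measurable_ratio V)

theorem ratio_eq_one_sub_mul_harm (hV : V ≠ 0) (hl : 0 < l) :
    ratio V l = 1 - (V⁻¹).toReal * harm V l := by
  rw [harm_eq_mul_ratio, ratio_eq_one_div hV hl, eq_sub_iff_add_eq]
  field_simp

theorem harm_eq_harm_div {W : ℝ≥0∞} (hV : V ≠ 0) (hW : W ≠ 0) (hl : 0 < l) :
    harm V l = harm W l / (1 + ((V⁻¹).toReal - (W⁻¹).toReal) * harm W l) := by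
  have hden : 1 + (V⁻¹).toReal * l =
      (1 + (W⁻¹).toReal * l) *
        (1 + ((V⁻¹).toReal - (W⁻¹).toReal) * (l * (1 / (1 + (W⁻¹).toReal * l)))) := by
    field_simp
    ring
  rw [harm_eq_mul_ratio, harm_eq_mul_ratio, ratio_eq_one_div hV hl, ratio_eq_one_div hW hl, hden,
    one_div, one_div, mul_inv, ← mul_assoc, ← div_eq_mul_inv]

end Ratio

/-- `E[λ V / (V + λ)] / δ`, the quantity whose inverse enters the definition of `Φ`. -/
noncomputable def harmMean (Pl : Measure ℝ) (δ : ℝ) (V : ℝ≥0∞) : ℝ :=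
  1 / δ * ∫ l, harm V l ∂Pl

theorem harmMean_top {Pl : Measure ℝ} {δ : ℝ} (hmean : ∫ l, l ∂Pl = δ) (hδ : δ ≠ 0) :
    harmMean Pl δ ⊤ = 1 := by
  simp [harmMean, harm, hmean, hδ]

theorem mse_zero (Pl : Measure ℝ) : mse Pl 0 = 0 := by
  simp [mse, ratio]

theorem Phi_zero (Pl : Measure ℝ) (δ : ℝ) : Phi Pl δ 0 = 0 := if_pos rfl

theorem Phi_of_ne_zero (Pl : Measure ℝ) (δ : ℝ) {V : ℝ≥0∞} (hV : V ≠ 0) :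
    Phi Pl δ V = ((harmMean Pl δ V)⁻¹ - (V⁻¹).toReal)⁻¹ := by
  rw [Phi, if_neg hV, harmMean, one_div (1 / δ * _)]

theorem integral_pos_of_ae_pos {α : Type*} [MeasurableSpace α] {μ : Measure α} [NeZero μ]
    {g : α → ℝ} (hg : Integrable g μ) (hpos : ∀ᵐ x ∂μ, 0 < g x) : 0 < ∫ x, g x ∂μ := by
  rw [integral_pos_iff_support_of_nonneg_ae (hpos.mono fun _ => le_of_lt) hg,
    pos_iff_ne_zero, ne_eq, measure_eq_zero_iff_ae_notMem]
  intro hzero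
  obtain ⟨x, hx, hx0⟩ := (hpos.and hzero).exists
  exact hx0 hx.ne'

section Law

variable {Pl : Measure ℝ} {δ : ℝ} {V W : ℝ≥0∞} (hpos : ∀ᵐ l ∂Pl, 0 < l)
include hpos

theorem mse_nonneg (V : ℝ≥0∞) : 0 ≤ mse Pl V :=
  integral_nonneg_of_ae (hpos.mono fun _ => ratio_nonneg V)

theorem integrable_ratio [IsFiniteMeasure Pl] (V : ℝ≥0∞) : Integrable (ratio V) Pl := by
  refine Integrable.of_bound (measurable_ratio V).aestronglyMeasurable 1 ?_
  filter_upwards [hpos] with l hl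
  exact (Real.norm_of_nonneg (ratio_nonneg V hl)).trans_le (ratio_le_one V hl)

theorem integrable_harm (hint : Integrable (fun l => l) Pl) (V : ℝ≥0∞) :
    Integrable (harm V) Pl := by
  refine hint.mono' (measurable_harm V).aestronglyMeasurable ?_
  filter_upwards [hpos] with l hl
  exact (Real.norm_of_nonneg (harm_nonneg V hl)).trans_le (harm_le V hl)

theorem continuous_mse [IsFiniteMeasure Pl] : Continuous (mse Pl) := by
  refine continuous_of_dominated (bound := fun _ => 1)
    (fun V => (measurable_ratio V).aestronglyMeasurable) (fun V => ?_) (integrable_const 1) ?_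
  · filter_upwards [hpos] with l hl
    exact (Real.norm_of_nonneg (ratio_nonneg V hl)).trans_le (ratio_le_one V hl)
  · filter_upwards [hpos] with l hl using continuous_ratio hl

theorem continuous_harmMean (hint : Integrable (fun l => l) Pl) :
    Continuous (harmMean Pl δ) := by
  refine continuous_const.mul (continuous_of_dominated
    (fun V => (measurable_harm V).aestronglyMeasurable) (fun V => ?_) hint ?_)
  · filter_upwards [hpos] with l hl
    exact (Real.norm_of_nonneg (harm_nonneg V hl)).trans_le (harm_le V hl)
  · filter_upwards [hpos] with l hl
    simpa only [harm_eq_mul_ratio] using (continuous_ratio hl).const_mul l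

theorem mse_pos [IsFiniteMeasure Pl] [NeZero Pl] (hV : V ≠ 0) : 0 < mse Pl V :=
  integral_pos_of_ae_pos (integrable_ratio hpos V) (hpos.mono fun _ => ratio_pos hV)

theorem harmMean_pos [NeZero Pl] (hint : Integrable (fun l => l) Pl) (hδ : 0 < δ) (hV : V ≠ 0) :
    0 < harmMean Pl δ V := by
  refine mul_pos (by positivity) (integral_pos_of_ae_pos (integrable_harm hpos hint V) ?_)
  filter_upwards [hpos] with l hl
  rw [harm_eq_mul_ratio]
  exact mul_pos hl (ratio_pos hV hl)

theorem mse_eq_one_sub [IsProbabilityMeasure Pl] (hδ : δ ≠ 0) (hint : Integrable (fun l => l) Pl)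
    (hV : V ≠ 0) : mse Pl V = 1 - δ * ((V⁻¹).toReal * harmMean Pl δ V) := by
  have hratio : mse Pl V = ∫ l, (1 - (V⁻¹).toReal * harm V l) ∂Pl :=
    integral_congr_ae (hpos.mono fun l hl => ratio_eq_one_sub_mul_harm hV hl)
  rw [hratio, integral_sub (integrable_const 1) ((integrable_harm hpos hint V).const_mul _),
    integral_const_mul, integral_const, probReal_univ, one_smul, harmMean]
  field_simp

variable [IsProbabilityMeasure Pl]

-- `harm V l = h / (1 + Δ h)` with `h = harm W l` and `Δ = 1 / V - 1 / W` is an infimum of affine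
-- functions of `h`; integrating each of them gives the same relation for the means. The factor
-- `1 / δ ≤ 1` only helps.
theorem inv_harmMean_sub_le (hint : Integrable (fun l => l) Pl) (hδ : 1 ≤ δ) (hV : V ≠ 0)
    (hVW : V ≤ W) :
    (harmMean Pl δ W)⁻¹ - (W⁻¹).toReal ≤ (harmMean Pl δ V)⁻¹ - (V⁻¹).toReal := by
  have hδ0 : 0 < δ := zero_lt_one.trans_le hδ
  have hW : W ≠ 0 := ((pos_iff_ne_zero.2 hV).trans_le hVW).ne'
  have hΔ : 0 ≤ (V⁻¹).toReal - (W⁻¹).toReal := sub_nonneg.2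
    (ENNReal.toReal_mono (ENNReal.inv_ne_top.2 hV) (ENNReal.inv_le_inv.2 hVW))
  have hm := harmMean_pos hpos hint hδ0 hW
  set Δ := (V⁻¹).toReal - (W⁻¹).toReal
  have hle : harmMean Pl δ V ≤ harmMean Pl δ W / (1 + Δ * harmMean Pl δ W) := by
    refine le_div_one_add_mul_of_forall_le_quadratic hm.le hΔ fun c => ?_
    have hquad : ∫ l, harm V l ∂Pl ≤ (1 - c * Δ) ^ 2 * ∫ l, harm W l ∂Pl + c ^ 2 * Δ := by
      calc ∫ l, harm V l ∂Pl
          ≤ ∫ l, ((1 - c * Δ) ^ 2 * harm W l + c ^ 2 * Δ) ∂Pl := by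
            refine integral_mono_ae (integrable_harm hpos hint V)
              (((integrable_harm hpos hint W).const_mul _).add (integrable_const _)) ?_
            filter_upwards [hpos] with l hl
            rw [harm_eq_harm_div hV hW hl]
            exact div_one_add_mul_le_quadratic (harm_nonneg W hl) hΔ c
        _ = (1 - c * Δ) ^ 2 * ∫ l, harm W l ∂Pl + c ^ 2 * Δ := by
            rw [integral_add ((integrable_harm hpos hint W).const_mul _) (integrable_const _),
              integral_const_mul, integral_const, probReal_univ, one_smul]
    calc harmMean Pl δ V
        ≤ 1 / δ * ((1 - c * Δ) ^ 2 * ∫ l, harm W l ∂Pl + c ^ 2 * Δ) :=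
          mul_le_mul_of_nonneg_left hquad (by positivity)
      _ = (1 - c * Δ) ^ 2 * harmMean Pl δ W + 1 / δ * (c ^ 2 * Δ) := by rw [harmMean]; ring
      _ ≤ (1 - c * Δ) ^ 2 * harmMean Pl δ W + c ^ 2 * Δ :=
          add_le_add_right (mul_le_of_le_one_left (by positivity) ((div_le_one hδ0).2 hδ)) _
  have hinv := inv_anti₀ (harmMean_pos hpos hint hδ0 hV) hle
  rw [inv_div, add_div, mul_div_cancel_right₀ _ hm.ne', one_div] at hinv
  linarith

end Law

section Phi

variable {Pl : Measure ℝ} [IsProbabilityMeasure Pl] {δ : ℝ} {V : ℝ≥0∞} (hpos : ∀ᵐ l ∂Pl, 0 < l)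
  (hmean : ∫ l, l ∂Pl = δ)

include hpos hmean

theorem one_le_inv_harmMean_sub (hδ : 1 ≤ δ) (hV : V ≠ 0) :
    1 ≤ (harmMean Pl δ V)⁻¹ - (V⁻¹).toReal := by
  have hδ0 : δ ≠ 0 := (zero_lt_one.trans_le hδ).ne'
  have hint : Integrable (fun l => l) Pl := Integrable.of_integral_ne_zero (hmean.trans_ne hδ0)
  simpa [harmMean_top hmean hδ0] using inv_harmMean_sub_le hpos hint hδ hV le_top

theorem Phi_pos (hδ : 1 ≤ δ) (hV : V ≠ 0) : 0 < Phi Pl δ V := by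
  rw [Phi_of_ne_zero _ _ hV]
  exact inv_pos.2 (zero_lt_one.trans_le (one_le_inv_harmMean_sub hpos hmean hδ hV))

theorem Phi_nonneg (hδ : 1 ≤ δ) (V : ℝ≥0∞) : 0 ≤ Phi Pl δ V := by
  rcases eq_or_ne V 0 with rfl | hV
  · exact (Phi_zero Pl δ).ge
  · exact (Phi_pos hpos hmean hδ hV).le

theorem Phi_le_one (hδ : 1 ≤ δ) (V : ℝ≥0∞) : Phi Pl δ V ≤ 1 := by
  rcases eq_or_ne V 0 with rfl | hV
  · exact (Phi_zero Pl δ).trans_le zero_le_one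
  · rw [Phi_of_ne_zero _ _ hV]
    exact inv_le_one_of_one_le₀ (one_le_inv_harmMean_sub hpos hmean hδ hV)

theorem Phi_monotone (hδ : 1 ≤ δ) : Monotone (Phi Pl δ) := by
  intro V W hVW
  rcases eq_or_ne V 0 with rfl | hV
  · exact (Phi_zero Pl δ).trans_le (Phi_nonneg hpos hmean hδ W)
  have hW : W ≠ 0 := ((pos_iff_ne_zero.2 hV).trans_le hVW).ne'
  have hint : Integrable (fun l => l) Pl := Integrable.of_integral_ne_zero
    (hmean.trans_ne (zero_lt_one.trans_le hδ).ne')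
  rw [Phi_of_ne_zero _ _ hV, Phi_of_ne_zero _ _ hW]
  exact inv_anti₀ (zero_lt_one.trans_le (one_le_inv_harmMean_sub hpos hmean hδ hW))
    (inv_harmMean_sub_le hpos hint hδ hV hVW)

theorem Phi_le_div (hδ : 1 < δ) (hV : V ≠ ⊤) : Phi Pl δ V ≤ V.toReal / (δ - 1) := by
  rcases eq_or_ne V 0 with rfl | hV0
  · simp [Phi_zero]
  have hδ0 : 0 < δ := zero_lt_one.trans hδ
  have hint : Integrable (fun l => l) Pl := Integrable.of_integral_ne_zero (hmean.trans_ne hδ0.ne')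
  have hV' := ENNReal.toReal_pos hV0 hV
  have hmul : δ * (V.toReal⁻¹ * harmMean Pl δ V) ≤ 1 := by
    have := mse_nonneg hpos V
    rw [mse_eq_one_sub hpos hδ0.ne' hint hV0, ENNReal.toReal_inv] at this
    linarith
  have hinv : δ * V.toReal⁻¹ ≤ (harmMean Pl δ V)⁻¹ := by
    rwa [le_inv_comm₀ (by positivity) (harmMean_pos hpos hint hδ0 hV0), ← one_div,
      le_div_iff₀' (by positivity), mul_assoc]
  rw [Phi_of_ne_zero _ _ hV0, ENNReal.toReal_inv, ← inv_div, div_eq_mul_inv (δ - 1)]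
  exact inv_anti₀ (mul_pos (sub_pos.2 hδ) (by positivity)) (by linarith)

theorem continuous_Phi (hδ : 1 < δ) : Continuous (Phi Pl δ) := by
  refine continuous_iff_continuousAt.2 fun V => ?_
  rcases eq_or_ne V 0 with rfl | hV
  · have hlim : Tendsto (fun W : ℝ≥0∞ => W.toReal / (δ - 1)) (𝓝 0) (𝓝 0) := by
      simpa using (ENNReal.tendsto_toReal ENNReal.zero_ne_top).div_const (δ - 1)
    rw [ContinuousAt, Phi_zero]
    refine tendsto_of_tendsto_of_tendsto_of_le_of_le' tendsto_const_nhds hlim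
      (Eventually.of_forall (Phi_nonneg hpos hmean hδ.le)) ?_
    filter_upwards [gt_mem_nhds ENNReal.zero_lt_top] with W hW
      using Phi_le_div hpos hmean hδ hW.ne
  · have hδ0 : 0 < δ := zero_lt_one.trans hδ
    have hint : Integrable (fun l => l) Pl :=
      Integrable.of_integral_ne_zero (hmean.trans_ne hδ0.ne')
    have hformula : ContinuousAt (fun W => ((harmMean Pl δ W)⁻¹ - (W⁻¹).toReal)⁻¹) V := by
      refine ContinuousAt.inv₀ (((continuous_harmMean hpos hint).continuousAt.inv₀
        (harmMean_pos hpos hint hδ0 hV).ne').sub ?_)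
        (zero_lt_one.trans_le (one_le_inv_harmMean_sub hpos hmean hδ.le hV)).ne'
      exact ContinuousAt.comp (g := ENNReal.toReal)
        (ENNReal.continuousAt_toReal (ENNReal.inv_ne_top.2 hV)) continuous_inv.continuousAt
    refine hformula.congr ?_
    filter_upwards [isOpen_ne.mem_nhds hV] with W hW using (Phi_of_ne_zero _ _ hW).symm

end Phi

/-! ### State evolution -/

theorem tendsto_iterate_nhdsWithin_Icc {α : Type*} [ConditionallyCompleteLinearOrder α]
    [TopologicalSpace α] [OrderTopology α] {T : α → α} {p q : α} (hpq : p ≤ q)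
    (hmono : MonotoneOn T (Icc p q)) (hp : p ≤ T p) (hq : T q ≤ q)
    (hcont : ∀ u ∈ Icc p q, ContinuousWithinAt T (Icc u q) u) (hlt : ∀ u ∈ Ioc p q, T u < u) :
    Tendsto (fun n => T^[n] q) atTop (𝓝[Icc p q] p) := by
  have hmaps : MapsTo T (Icc p q) (Icc p q) := fun u hu =>
    ⟨hp.trans (hmono (left_mem_Icc.2 hpq) hu hu.1), (hmono hu (right_mem_Icc.2 hpq) hu.2).trans hq⟩
  have hmem : ∀ n, T^[n] q ∈ Icc p q := fun n => hmaps.iterate n (right_mem_Icc.2 hpq)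
  have hanti : Antitone fun n => T^[n] q := by
    refine antitone_nat_of_succ_le fun n => ?_
    induction n with
    | zero => exact hq
    | succ n ih =>
      simpa only [← Function.iterate_succ_apply' T] using hmono (hmem (n + 1)) (hmem n) ih
  have hbdd : BddBelow (range fun n => T^[n] q) := ⟨p, forall_mem_range.2 fun n => (hmem n).1⟩
  have hlim := tendsto_atTop_ciInf hanti hbdd
  set L := ⨅ n, T^[n] q
  have hL : L ∈ Icc p q := ⟨le_ciInf fun n => (hmem n).1, ciInf_le hbdd 0⟩
  have hTlim : Tendsto (fun n => T^[n + 1] q) atTop (𝓝 (T L)) := by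
    simp only [Function.iterate_succ_apply']
    exact (hcont L hL).tendsto.comp (tendsto_nhdsWithin_iff.2
      ⟨hlim, Eventually.of_forall fun n => ⟨ciInf_le hbdd n, (hmem n).2⟩⟩)
  have hfix : T L = L := tendsto_nhds_unique hTlim ((tendsto_add_atTop_iff_nat 1).2 hlim)
  have hLp : L = p := by
    by_contra hne
    exact (hlt L ⟨hL.1.lt_of_ne' hne, hL.2⟩).ne hfix
  exact tendsto_nhdsWithin_iff.2 ⟨hLp ▸ hlim, Eventually.of_forall hmem⟩

/-- One step `V_r^{t-1} ↦ V_r^t` of the state evolution of GLM-EP. -/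
noncomputable def evolutionMap (f : ℝ → ℝ) (Pl : Measure ℝ) (δ v : ℝ) : ℝ :=
  Phi Pl δ (phi f v)

theorem IsStateEvolution.left_eq_phi_iterate {f : ℝ → ℝ} {Pl : Measure ℝ} {δ : ℝ}
    {Vl : ℕ → ℝ≥0∞} {Vr : ℕ → ℝ} (hSE : IsStateEvolution f Pl δ Vl Vr) (t : ℕ) :
    Vl t = phi f ((evolutionMap f Pl δ)^[t] 1) := by
  induction t with
  | zero => exact hSE.left_zero
  | succ t ih => rw [hSE.left_succ, hSE.right, ih, Function.iterate_succ_apply', evolutionMap]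

theorem VrStar_mem_Icc (f : ℝ → ℝ) (Pl : Measure ℝ) (δ : ℝ) : VrStar f Pl δ ∈ Icc (0 : ℝ) 1 := by
  unfold VrStar
  split_ifs with hne
  · obtain ⟨v, hv⟩ := hne
    exact ⟨Real.sInf_nonneg fun w hw => hw.1.1,
      (csInf_le ⟨0, fun w hw => hw.1.1⟩ hv).trans hv.1.2⟩
  · exact ⟨zero_le_one, le_rfl⟩

theorem VrStar_le_of_mem_goodSet {f : ℝ → ℝ} {Pl : Measure ℝ} {δ v : ℝ}
    (hv : v ∈ goodSet f Pl δ) : VrStar f Pl δ ≤ v := by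
  rw [VrStar, if_pos ⟨v, hv⟩]
  exact csInf_le ⟨0, fun w hw => hw.1.1⟩ hv

section Evolution

variable {f : ℝ → ℝ} {Pl : Measure ℝ} [IsProbabilityMeasure Pl] {δ : ℝ} (hf : Measurable f)
  (hpos : ∀ᵐ l ∂Pl, 0 < l) (hmean : ∫ l, l ∂Pl = δ) (hδ : 1 < δ)
include hf hpos hmean hδ

theorem evolutionMap_monotoneOn : MonotoneOn (evolutionMap f Pl δ) (Icc 0 1) :=
  (Phi_monotone hpos hmean hδ.le).comp_monotoneOn (phi_monotoneOn hf)

theorem PFun_pos_iff {v : ℝ} (hv : v ∈ Ioc (0 : ℝ) 1) :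
    0 < PFun f Pl δ v ↔ evolutionMap f Pl δ v < v := by
  have hv0 := hv.1
  rcases (channelMMSE_nonneg γ f (v⁻¹ - 1)).eq_or_lt' with hmmse | hmmse
  · rw [← mmseZ_eq_channelMMSE] at hmmse
    simp [PFun, (phi_eq_zero_iff hv0).2 hmmse, hmmse, mse_zero, evolutionMap, Phi_zero, hv0, hδ]
  rw [← mmseZ_eq_channelMMSE] at hmmse
  have hδ0 : 0 < δ := zero_lt_one.trans hδ
  have hint : Integrable (fun l => l) Pl := Integrable.of_integral_ne_zero (hmean.trans_ne hδ0.ne')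
  have hV : phi f v ≠ 0 := (phi_eq_zero_iff hv0).not.2 hmmse.ne'
  have hs := toReal_inv_phi hf hv hmmse
  have hm := harmMean_pos hpos hint hδ0 hV
  have hone := one_le_inv_harmMean_sub hpos hmean hδ.le hV
  rw [PFun, mse_eq_one_sub hpos hδ0.ne' hint hV, evolutionMap, Phi_of_ne_zero _ _ hV,
    inv_lt_comm₀ (zero_lt_one.trans_le hone) hv0]
  rcases (ENNReal.toReal_nonneg (a := (phi f v)⁻¹)).eq_or_lt' with hs0 | hs0
  · have htop : phi f v = ⊤ := by
      simpa [ENNReal.toReal_eq_zero_iff, hV] using hs0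
    have hself : mmseZ f v = v := inv_injective (by linarith)
    have hle : (1 : ℝ) ≤ v⁻¹ := (one_le_inv₀ hv0).2 hv.2
    simp [htop, hself, harmMean_top hmean hδ0.ne', hv0.ne', hle]
  · set s := ((phi f v)⁻¹).toReal
    set m := harmMean Pl δ (phi f v)
    have hfactor : 1 - δ * (s * m) - (1 - δ * (1 - mmseZ f v / v)) =
        δ * (s * m) * (v / (1 + s * v)) * (m⁻¹ - s - v⁻¹) := by
      have hinv : (mmseZ f v)⁻¹ = s + v⁻¹ := by linarith
      rw [← inv_inv (mmseZ f v), hinv]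
      field_simp
      ring
    rw [hfactor, mul_pos_iff_of_pos_left (by positivity), sub_pos]

-- `P(0) = MSE_λ(φ(0)) - 1 + δ` because of the convention `x / 0 = 0`.
theorem mem_goodSet_iff {v : ℝ} : v ∈ goodSet f Pl δ ↔
    v ∈ Icc (0 : ℝ) 1 ∧ ∀ u ∈ Icc v 1, 0 < u → evolutionMap f Pl δ u < u := by
  have hzero : 0 < PFun f Pl δ 0 := by
    have := mse_nonneg hpos (phi f 0)
    rw [PFun, div_zero]
    linarith
  refine and_congr_right fun hv => forall₂_congr fun u hu => ?_
  rcases (hv.1.trans hu.1).eq_or_lt with rfl | hu0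
  · exact iff_of_true hzero fun h0 => absurd h0 (lt_irrefl 0)
  · rw [PFun_pos_iff hf hpos hmean hδ ⟨hu0, hu.2⟩, forall_prop_of_true hu0]

theorem evolutionMap_lt_of_VrStar_lt {u : ℝ} (hu : u ∈ Ioc (VrStar f Pl δ) 1) :
    evolutionMap f Pl δ u < u := by
  have hu0 : 0 < u := (VrStar_mem_Icc f Pl δ).1.trans_lt hu.1
  unfold VrStar at hu
  split_ifs at hu with hne
  · obtain ⟨v, hv, hvu⟩ := exists_lt_of_csInf_lt hne hu.1
    exact ((mem_goodSet_iff hf hpos hmean hδ).1 hv).2 u ⟨hvu.le, hu.2⟩ hu0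
  · exact absurd hu.1 hu.2.not_gt

-- Otherwise every `w` between `T(V_r^⋆)` and `V_r^⋆` would lie in the set defining `V_r^⋆`.
theorem VrStar_le_evolutionMap : VrStar f Pl δ ≤ evolutionMap f Pl δ (VrStar f Pl δ) := by
  by_contra! hlt
  obtain ⟨w, hTw, hw⟩ := exists_between hlt
  have hmem := VrStar_mem_Icc f Pl δ
  refine hw.not_ge (VrStar_le_of_mem_goodSet ((mem_goodSet_iff hf hpos hmean hδ).2
    ⟨⟨(Phi_nonneg hpos hmean hδ.le _).trans hTw.le, hw.le.trans hmem.2⟩, fun u hu hu0 => ?_⟩))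
  rcases le_or_gt u (VrStar f Pl δ) with hle | hgt
  · exact ((evolutionMap_monotoneOn hf hpos hmean hδ ⟨hu0.le, hu.2⟩ hmem hle).trans_lt
      hTw).trans_le hu.1
  · exact evolutionMap_lt_of_VrStar_lt hf hpos hmean hδ ⟨hgt, hu.2⟩

theorem tendsto_evolutionMap_iterate :
    Tendsto (fun t => (evolutionMap f Pl δ)^[t] 1) atTop
      (𝓝[Icc (VrStar f Pl δ) 1] VrStar f Pl δ) := by
  have hmem := VrStar_mem_Icc f Pl δ
  exact tendsto_iterate_nhdsWithin_Icc hmem.2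
    ((evolutionMap_monotoneOn hf hpos hmean hδ).mono (Icc_subset_Icc_left hmem.1))
    (VrStar_le_evolutionMap hf hpos hmean hδ) (Phi_le_one hpos hmean hδ.le _)
    (fun u hu => (continuous_Phi hpos hmean hδ).continuousAt.comp_continuousWithinAt
      (continuousWithinAt_phi hf ⟨hmem.1.trans hu.1, hu.2⟩))
    fun u hu => evolutionMap_lt_of_VrStar_lt hf hpos hmean hδ hu

theorem tendsto_mse_finalMSE {Vl : ℕ → ℝ≥0∞} {Vr : ℕ → ℝ}
    (hSE : IsStateEvolution f Pl δ Vl Vr) :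
    Tendsto (fun t => mse Pl (Vl t)) atTop (𝓝 (finalMSE f Pl δ)) := by
  simp only [hSE.left_eq_phi_iterate]
  exact ((continuous_mse hpos).tendsto _).comp
    ((continuousWithinAt_phi hf (VrStar_mem_Icc f Pl δ)).tendsto.comp
      (tendsto_evolutionMap_iterate hf hpos hmean hδ))

theorem phi_zero_of_forall_PFun_pos (hP : ∀ v ∈ Ioc (0 : ℝ) 1, 0 < PFun f Pl δ v) :
    phi f 0 = 0 := by
  by_contra hne
  have hmem : evolutionMap f Pl δ 0 ∈ Ioc (0 : ℝ) 1 :=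
    ⟨Phi_pos hpos hmean hδ.le hne, Phi_le_one hpos hmean hδ.le _⟩
  exact ((PFun_pos_iff hf hpos hmean hδ hmem).1 (hP _ hmem)).not_ge
    (evolutionMap_monotoneOn hf hpos hmean hδ ⟨le_rfl, zero_le_one⟩ (Ioc_subset_Icc_self hmem)
      hmem.1.le)

theorem finalMSE_eq_zero_iff :
    finalMSE f Pl δ = 0 ↔ ∀ v ∈ Ioc (0 : ℝ) 1, 0 < PFun f Pl δ v := by
  constructor
  · intro hzero v hv
    have hphi : phi f (VrStar f Pl δ) = 0 := by
      by_contra hne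
      exact (mse_pos hpos hne).ne' hzero
    have hstar : VrStar f Pl δ ≤ 0 := by
      simpa only [evolutionMap, hphi, Phi_zero] using VrStar_le_evolutionMap hf hpos hmean hδ
    exact (PFun_pos_iff hf hpos hmean hδ hv).2
      (evolutionMap_lt_of_VrStar_lt hf hpos hmean hδ ⟨hstar.trans_lt hv.1, hv.2⟩)
  · intro hP
    have hgood : (0 : ℝ) ∈ goodSet f Pl δ := (mem_goodSet_iff hf hpos hmean hδ).2
      ⟨⟨le_rfl, zero_le_one⟩, fun u hu hu0 =>
        (PFun_pos_iff hf hpos hmean hδ ⟨hu0, hu.2⟩).1 (hP u ⟨hu0, hu.2⟩)⟩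
    have hstar : VrStar f Pl δ = 0 :=
      (VrStar_le_of_mem_goodSet hgood).antisymm (VrStar_mem_Icc f Pl δ).1
    rw [finalMSE, hstar, phi_zero_of_forall_PFun_pos hf hpos hmean hδ hP, mse_zero]

-- As `v → 0` the term `MSE_λ(φ(v))` vanishes, whereas `mmse_z(v) / v` stays above every number
-- smaller than the probability of the flat sections.
theorem inv_measure_flatSet_compl_le (hP : ∀ v ∈ Ioc (0 : ℝ) 1, 0 < PFun f Pl δ v) :
    (γ (flatSet f)ᶜ)⁻¹ ≤ ENNReal.ofReal δ := by
  have hδ0 : 0 < δ := zero_lt_one.trans hδ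
  have hlim : Tendsto (fun v => mse Pl (phiPos f v)) (𝓝[>] 0) (𝓝 0) := by
    have hphi := tendsto_phiPos_nhdsGT_zero hf
    rw [phi_zero_of_forall_PFun_pos hf hpos hmean hδ hP] at hphi
    have hmse := ((continuous_mse hpos).tendsto 0).comp hphi
    rwa [mse_zero] at hmse
  have hflat : (γ).real (flatSet f) ≤ 1 - δ⁻¹ := by
    refine le_of_forall_lt_imp_le_of_dense fun c hc => ?_
    suffices hc' : 1 - δ * (1 - c) ≤ 0 by
      rw [le_sub_comm, inv_le_iff_one_le_mul₀' hδ0]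
      linarith
    refine ge_of_tendsto hlim ?_
    filter_upwards [eventually_mul_le_mmseZ hf hc, Ioo_mem_nhdsGT zero_lt_one] with v hcv hv
    have hPv := hP v ⟨hv.1, hv.2.le⟩
    rw [PFun, phi_of_pos hv.1] at hPv
    have hratio : δ * c ≤ δ * (mmseZ f v / v) :=
      mul_le_mul_of_nonneg_left ((le_div_iff₀ hv.1).2 hcv) hδ0.le
    linarith
  rw [ENNReal.inv_le_iff_inv_le, ← ENNReal.ofReal_inv_of_pos hδ0, ← ofReal_measureReal,
    probReal_compl_eq_one_sub (isOpen_flatSet f).measurableSet]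
  exact ENNReal.ofReal_le_ofReal (le_sub_comm.1 hflat)

end Evolution

/-! ### Shannon entropy of discrete measures -/

section ShannonEntropy

variable {α β : Type*} [MeasurableSpace α] [MeasurableSpace β]

theorem shannonEntropy_map_of_injective [MeasurableSingletonClass β] (p : Measure α) {g : α → β}
    (hg : Measurable g) (hinj : Function.Injective g) :
    shannonEntropy (p.map g) = shannonEntropy p := by
  have hmap : ∀ y, (p.map g).real {y} = p.real (g ⁻¹' {y}) := fun y =>
    map_measureReal_apply hg (measurableSet_singleton y)
  rw [shannonEntropy, ← hinj.tsum_eq]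
  · have hfiber : ∀ x, g ⁻¹' {g x} = {x} := fun x => by
      rw [← image_singleton, preimage_image_eq _ hinj]
    simp only [hmap, hfiber, shannonEntropy]
  · refine Function.support_subset_iff'.2 fun y hy => ?_
    simp only [hmap, preimage_singleton_eq_empty.2 hy, measureReal_empty, Real.negMulLog_zero,
      ENNReal.ofReal_zero]

theorem shannonEntropy_eq_lintegral [Countable α] [MeasurableSingletonClass α] (p : Measure α)
    [IsFiniteMeasure p] :
    shannonEntropy p = ∫⁻ x, ENNReal.ofReal (-Real.log (p.real {x})) ∂p := by
  rw [lintegral_countable']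
  refine tsum_congr fun x => ?_
  rw [← ofReal_measureReal, ← ENNReal.ofReal_mul' measureReal_nonneg, Real.negMulLog, neg_mul,
    neg_mul, mul_comm]

theorem mul_measure_le_shannonEntropy [Countable α] [MeasurableSingletonClass α] (p : Measure α)
    [IsFiniteMeasure p] (L : ℝ) :
    ENNReal.ofReal L * p {x | p.real {x} < Real.exp (-L)} ≤ shannonEntropy p := by
  have hpos : ∀ᵐ x ∂p, 0 < p.real {x} :=
    ae_iff_of_countable.2 fun x hx => ENNReal.toReal_pos hx (measure_ne_top p _)
  rw [shannonEntropy_eq_lintegral]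
  refine le_trans ?_ (mul_meas_ge_le_lintegral₀
    (measurable_of_countable fun x => ENNReal.ofReal (-Real.log (p.real {x}))).aemeasurable
    (ENNReal.ofReal L))
  refine mul_le_mul_right (measure_mono_ae ?_) _
  filter_upwards [hpos] with x hx hlt
  exact ENNReal.ofReal_le_ofReal (le_neg.2 ((Real.log_lt_iff_lt_exp hx).2 hlt).le)

theorem shannonEntropy_le_card (p : Measure α) {S : Finset α} (hS : p (↑S)ᶜ = 0) :
    shannonEntropy p ≤ S.card := by
  have hnull : ∀ x ∉ S, ENNReal.ofReal (Real.negMulLog (p.real {x})) = 0 := fun x hx => by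
    rw [measureReal_def, measure_mono_null (singleton_subset_iff.2 hx) hS, ENNReal.toReal_zero,
      Real.negMulLog_zero, ENNReal.ofReal_zero]
  rw [shannonEntropy, tsum_eq_sum hnull, ← nsmul_one]
  refine Finset.sum_le_card_nsmul _ _ _ fun x _ => ENNReal.ofReal_le_one.2 ?_
  exact (Real.negMulLog_le_one_sub_self measureReal_nonneg).trans (sub_le_self 1 measureReal_nonneg)

theorem negMulLog_add_le {x y : ℝ} (hx : 0 ≤ x) (hy : 0 ≤ y) :
    Real.negMulLog (x + y) ≤ Real.negMulLog x + Real.negMulLog y := by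
  rcases hx.eq_or_lt with rfl | hx
  · simp
  rcases hy.eq_or_lt with rfl | hy
  · simp
  have hlogx := mul_le_mul_of_nonneg_left (Real.log_le_log hx (le_add_of_nonneg_right hy.le)) hx.le
  have hlogy := mul_le_mul_of_nonneg_left (Real.log_le_log hy (le_add_of_nonneg_left hx.le)) hy.le
  simp only [Real.negMulLog]
  linarith

theorem shannonEntropy_add_le (p q : Measure α) [IsFiniteMeasure p] [IsFiniteMeasure q] :
    shannonEntropy (p + q) ≤ shannonEntropy p + shannonEntropy q := by
  simp only [shannonEntropy]
  rw [← ENNReal.tsum_add]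
  refine ENNReal.tsum_le_tsum fun x => le_trans ?_ ENNReal.ofReal_add_le
  rw [measureReal_add_apply]
  exact ENNReal.ofReal_le_ofReal (negMulLog_add_le measureReal_nonneg measureReal_nonneg)

-- One term of Gibbs' inequality against a law that splits an atom `r` evenly among `m` points.
theorem negMulLog_le_add_div {x r m : ℝ} (hx : 0 ≤ x) (hxr : x ≤ r) (hm : 0 < m) :
    Real.negMulLog x ≤ x * Real.log m + x * (-Real.log r) + r / m := by
  rcases hx.eq_or_lt with rfl | hx
  · simp only [Real.negMulLog_zero, zero_mul, zero_add]
    positivity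
  have hr := hx.trans_le hxr
  have hlog := Real.log_le_sub_one_of_pos (show 0 < r / m / x by positivity)
  rw [Real.log_div (by positivity) hx.ne', Real.log_div hr.ne' hm.ne'] at hlog
  have hmul := mul_le_mul_of_nonneg_left hlog hx.le
  have hcancel : x * (r / m / x - 1) = r / m - x := by field_simp
  simp only [Real.negMulLog]
  linarith

end ShannonEntropy

/-! ### Information dimension -/

/-- The law of the index `k = ⌊M x⌋` of the bin `[k / M, (k + 1) / M)` containing `x`, for `x`
distributed according to `ν`. Unlike the law of `quantize M x`, it lives on a countable type. -/
noncomputable def binLaw (ν : Measure ℝ) (M : ℕ) : Measure ℤ :=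
  ν.map fun x => ⌊(M : ℝ) * x⌋

@[fun_prop]
theorem measurable_floor_mul (M : ℕ) : Measurable fun x : ℝ => ⌊(M : ℝ) * x⌋ :=
  Int.measurable_floor.comp (measurable_const_mul _)

section BinLaw

variable (ν : Measure ℝ) {M : ℕ}

instance [IsFiniteMeasure ν] : IsFiniteMeasure (binLaw ν M) := by
  unfold binLaw
  infer_instance

theorem binLaw_apply (M : ℕ) (s : Set ℤ) :
    binLaw ν M s = ν ((fun x => ⌊(M : ℝ) * x⌋) ⁻¹' s) :=
  Measure.map_apply (measurable_floor_mul M) MeasurableSet.of_discrete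

theorem binLaw_univ (M : ℕ) : binLaw ν M univ = ν univ := by
  rw [binLaw_apply, preimage_univ]

theorem binLaw_add (μ ν : Measure ℝ) (M : ℕ) : binLaw (μ + ν) M = binLaw μ M + binLaw ν M :=
  Measure.map_add μ ν (measurable_floor_mul M)

theorem binLaw_mono {μ ν : Measure ℝ} (h : μ ≤ ν) (M : ℕ) : binLaw μ M ≤ binLaw ν M :=
  Measure.map_mono h (measurable_floor_mul M)

theorem binLaw_volume_singleton (hM : M ≠ 0) (k : ℤ) :
    binLaw volume M {k} = (M : ℝ≥0∞)⁻¹ := by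
  have hM' : (0 : ℝ) < M := by positivity
  have hbin : (fun x : ℝ => ⌊(M : ℝ) * x⌋) ⁻¹' {k} = Ico ((k : ℝ) / M) ((k + 1) / M) := by
    ext x
    rw [mem_preimage, mem_singleton_iff, Int.floor_eq_iff, mem_Ico, div_le_iff₀ hM',
      lt_div_iff₀ hM', mul_comm]
  rw [binLaw_apply, hbin, Real.volume_Ico, ← sub_div, add_sub_cancel_left, one_div,
    ENNReal.ofReal_inv_of_pos hM', ENNReal.ofReal_natCast]

theorem binLaw_map_ediv (hM : M ≠ 0) : (binLaw ν M).map (· / (M : ℤ)) = binLaw ν 1 := by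
  have hM' : (M : ℝ) ≠ 0 := by positivity
  rw [binLaw, Measure.map_map .of_discrete (measurable_floor_mul M), binLaw]
  congr 1 with x
  rw [Function.comp_apply, ← Int.floor_div_natCast, mul_div_cancel_left₀ _ hM', Nat.cast_one,
    one_mul]

theorem lintegral_binLaw_ediv (hM : M ≠ 0) (h : ℤ → ℝ≥0∞) :
    ∫⁻ k, h (k / M) ∂binLaw ν M = ∫⁻ j, h j ∂binLaw ν 1 := by
  rw [← binLaw_map_ediv ν hM, lintegral_map .of_discrete .of_discrete]

theorem shannonEntropy_map_quantize (hM : M ≠ 0) :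
    shannonEntropy (ν.map (quantize M)) = shannonEntropy (binLaw ν M) := by
  have hM' : (M : ℝ) ≠ 0 := by positivity
  have hinj : Function.Injective fun k : ℤ => (k : ℝ) / M :=
    fun j k h => Int.cast_injective ((div_left_inj' hM').1 h)
  rw [← shannonEntropy_map_of_injective _ .of_discrete hinj, binLaw,
    Measure.map_map .of_discrete (measurable_floor_mul M)]
  rfl

theorem shannonEntropy_map_floor {Ω : Type*} [MeasurableSpace Ω] (μ : Measure Ω) {f : Ω → ℝ}
    (hf : Measurable f) :
    shannonEntropy (μ.map fun ω => ⌊f ω⌋) = shannonEntropy (binLaw (μ.map f) 1) := by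
  rw [binLaw, Measure.map_map (measurable_floor_mul 1) hf]
  simp only [Function.comp_def, Nat.cast_one, one_mul]

theorem shannonEntropy_binLaw_le_card {S : Finset ℝ} (hS : ν (↑S)ᶜ = 0) (M : ℕ) :
    shannonEntropy (binLaw ν M) ≤ S.card := by
  refine (shannonEntropy_le_card _ (S := S.image fun x => ⌊(M : ℝ) * x⌋) ?_).trans
    (Nat.cast_le.2 Finset.card_image_le)
  rw [binLaw_apply]
  exact measure_mono_null (fun x hx hxS => hx (Finset.mem_image_of_mem _ hxS)) hS

theorem binLaw_singleton_le (hM : M ≠ 0) (k : ℤ) :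
    binLaw ν M {k} ≤ binLaw ν 1 {k / (M : ℤ)} := by
  rw [← binLaw_map_ediv ν hM, Measure.map_apply .of_discrete .of_discrete]
  exact measure_mono (singleton_subset_iff.2 rfl)

theorem lintegral_singleton_binLaw_volume (p : Measure ℤ) (hM : M ≠ 0) :
    ∫⁻ k, p {k} ∂binLaw volume M = p univ / M := by
  rw [lintegral_countable', ← lintegral_one, lintegral_countable']
  simp only [binLaw_volume_singleton hM, ENNReal.tsum_mul_right, one_mul, div_eq_mul_inv]

theorem ofReal_negMulLog_binLaw_singleton_le {κ ν : Measure ℝ} [IsFiniteMeasure ν] (hκ : κ ≤ ν)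
    (hM : M ≠ 0) (k : ℤ) :
    ENNReal.ofReal (Real.negMulLog ((binLaw κ M).real {k})) ≤
      ENNReal.ofReal (Real.log M) * binLaw κ M {k} +
        ENNReal.ofReal (-Real.log ((binLaw ν 1).real {k / (M : ℤ)})) * binLaw κ M {k} +
        binLaw ν 1 {k / (M : ℤ)} * binLaw volume M {k} := by
  have : IsFiniteMeasure κ := isFiniteMeasure_of_le ν hκ
  have hM' : (0 : ℝ) < M := by positivity
  have hle : (binLaw κ M).real {k} ≤ (binLaw ν 1).real {k / (M : ℤ)} :=
    ENNReal.toReal_mono (measure_ne_top _ _)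
      ((binLaw_mono hκ M _).trans (binLaw_singleton_le ν hM k))
  refine (ENNReal.ofReal_le_ofReal (negMulLog_le_add_div measureReal_nonneg hle hM')).trans
    (ENNReal.ofReal_add_le.trans ?_)
  refine add_le_add (ENNReal.ofReal_add_le.trans_eq ?_) (le_of_eq ?_)
  · rw [ENNReal.ofReal_mul measureReal_nonneg, ENNReal.ofReal_mul measureReal_nonneg,
      ofReal_measureReal, mul_comm, mul_comm (binLaw κ M {k})]
  · rw [ENNReal.ofReal_div_of_pos hM', ENNReal.ofReal_natCast, ofReal_measureReal,
      binLaw_volume_singleton hM, div_eq_mul_inv]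

theorem shannonEntropy_binLaw_le {κ ν : Measure ℝ} [IsProbabilityMeasure ν] (hκ : κ ≤ ν)
    (hM : M ≠ 0) :
    shannonEntropy (binLaw κ M) ≤
      ENNReal.ofReal (Real.log M) * κ univ + shannonEntropy (binLaw ν 1) + 1 := by
  set r : ℤ → ℝ≥0∞ := fun j => ENNReal.ofReal (-Real.log ((binLaw ν 1).real {j}))
  have hcoarse : ∫⁻ k, r (k / M) ∂binLaw κ M ≤ shannonEntropy (binLaw ν 1) := by
    rw [shannonEntropy_eq_lintegral, lintegral_binLaw_ediv κ hM r]
    exact lintegral_mono' (binLaw_mono hκ 1) le_rfl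
  calc shannonEntropy (binLaw κ M)
      ≤ ∫⁻ _, ENNReal.ofReal (Real.log M) ∂binLaw κ M + ∫⁻ k, r (k / M) ∂binLaw κ M +
          ∫⁻ k, binLaw ν 1 {k / (M : ℤ)} ∂binLaw volume M := by
        simp only [lintegral_countable', ← ENNReal.tsum_add]
        exact ENNReal.tsum_le_tsum (ofReal_negMulLog_binLaw_singleton_le hκ hM)
    _ = ENNReal.ofReal (Real.log M) * κ univ + ∫⁻ k, r (k / M) ∂binLaw κ M + 1 := by
        rw [lintegral_const, binLaw_univ, lintegral_binLaw_ediv volume hM fun j => binLaw ν 1 {j},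
          lintegral_singleton_binLaw_volume _ one_ne_zero, binLaw_univ ν, measure_univ (μ := ν),
          Nat.cast_one, div_one]
    _ ≤ ENNReal.ofReal (Real.log M) * κ univ + shannonEntropy (binLaw ν 1) + 1 := by
        gcongr

/-- The bins of probability at least `exp (√(log M)) / M`. There are so few of them that an
absolutely continuous law does not charge them asymptotically, whereas each of the other bins
contributes almost `log M` times its probability to the entropy. -/
def heavyBins (M : ℕ) : Set ℤ :=
  {k | Real.exp (-(Real.log M - √(Real.log M))) ≤ (binLaw ν M).real {k}}

theorem binLaw_volume_heavyBins_le [IsProbabilityMeasure ν] (hM : M ≠ 0) :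
    binLaw volume M (heavyBins ν M) ≤ ENNReal.ofReal (Real.exp (-√(Real.log M))) := by
  have hM' : (0 : ℝ) < M := by positivity
  set θ := Real.exp (-(Real.log M - √(Real.log M))) with hθ
  have hsub : heavyBins ν M ⊆ {k | ENNReal.ofReal θ ≤ binLaw ν M {k}} := fun k hk =>
    ENNReal.ofReal_le_of_le_toReal hk
  have hmarkov : ENNReal.ofReal θ * binLaw volume M {k | ENNReal.ofReal θ ≤ binLaw ν M {k}} ≤
      (M : ℝ≥0∞)⁻¹ := by
    refine (mul_meas_ge_le_lintegral₀ (measurable_of_countable _).aemeasurable _).trans_eq ?_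
    rw [lintegral_singleton_binLaw_volume _ hM, binLaw_univ, measure_univ, one_div]
  have hexp : Real.exp (-√(Real.log M)) = (M : ℝ)⁻¹ / θ := by
    rw [hθ, ← Real.exp_log (inv_pos.2 hM'), Real.log_inv, ← Real.exp_sub]
    congr 1
    ring
  rw [hexp, ENNReal.ofReal_div_of_pos (Real.exp_pos _), ENNReal.ofReal_inv_of_pos hM',
    ENNReal.ofReal_natCast, ENNReal.le_div_iff_mul_le
      (Or.inl (ENNReal.ofReal_pos.2 (Real.exp_pos _)).ne') (Or.inl ENNReal.ofReal_ne_top), mul_comm]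
  exact (mul_le_mul_right (measure_mono hsub) _).trans hmarkov

end BinLaw

theorem tendsto_log_natCast_atTop : Tendsto (fun M : ℕ => Real.log M) atTop atTop :=
  Real.tendsto_log_atTop.comp tendsto_natCast_atTop_atTop

theorem tendsto_binLaw_heavyBins (ν : Measure ℝ) [IsProbabilityMeasure ν] {κ : Measure ℝ}
    [IsFiniteMeasure κ] (hκ : κ ≪ volume) :
    Tendsto (fun M => binLaw κ M (heavyBins ν M)) atTop (𝓝 0) := by
  have hexp : Tendsto (fun M : ℕ => ENNReal.ofReal (Real.exp (-√(Real.log M)))) atTop (𝓝 0) := by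
    rw [← ENNReal.ofReal_zero]
    exact ENNReal.tendsto_ofReal (Real.tendsto_exp_neg_atTop_nhds_zero.comp
      (Real.tendsto_sqrt_atTop.comp tendsto_log_natCast_atTop))
  have hvol : Tendsto (fun M => binLaw volume M (heavyBins ν M)) atTop (𝓝 0) := by
    refine tendsto_of_tendsto_of_tendsto_of_le_of_le' tendsto_const_nhds hexp
      (Eventually.of_forall fun _ => zero_le) ?_
    filter_upwards [eventually_ne_atTop 0] with M hM
    exact binLaw_volume_heavyBins_le ν hM
  simp only [binLaw_apply] at hvol ⊢
  simpa only [Measure.setLIntegral_rnDeriv hκ] using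
    tendsto_setLIntegral_zero (Measure.lintegral_rnDeriv_lt_top κ volume).ne hvol

theorem tendsto_log_sub_sqrt_log_div_log :
    Tendsto (fun M : ℕ => ENNReal.ofReal (Real.log M - √(Real.log M)) /
      ENNReal.ofReal (Real.log M)) atTop (𝓝 1) := by
  have hsqrt : Tendsto (fun M : ℕ => 1 - 1 / √(Real.log M)) atTop (𝓝 1) := by
    simpa only [sub_zero, Function.comp_apply] using
      tendsto_const_nhds.sub (tendsto_const_nhds.div_atTop
        (Real.tendsto_sqrt_atTop.comp tendsto_log_natCast_atTop))
  rw [← ENNReal.ofReal_one]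
  refine (ENNReal.tendsto_ofReal hsqrt).congr' ?_
  filter_upwards [tendsto_log_natCast_atTop.eventually_gt_atTop 0] with M hlog
  rw [← ENNReal.ofReal_div_of_pos hlog, sub_div, div_self hlog.ne', Real.sqrt_div_self', one_div]

theorem eventually_lt_shannonEntropy_div_log {κ ν : Measure ℝ} [IsProbabilityMeasure ν]
    (hκν : κ ≤ ν) (hκ : κ ≪ volume) {a : ℝ≥0∞} (ha : a < κ univ) :
    ∀ᶠ M : ℕ in atTop, a < shannonEntropy (binLaw ν M) / ENNReal.ofReal (Real.log M) := by
  have : IsFiniteMeasure κ := isFiniteMeasure_of_le ν hκν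
  have hlim : Tendsto (fun M : ℕ => ENNReal.ofReal (Real.log M - √(Real.log M)) /
      ENNReal.ofReal (Real.log M) * (κ univ - binLaw κ M (heavyBins ν M))) atTop
      (𝓝 (κ univ)) := by
    simpa only [tsub_zero, one_mul] using ENNReal.Tendsto.mul tendsto_log_sub_sqrt_log_div_log
      (Or.inl one_ne_zero) (ENNReal.Tendsto.sub tendsto_const_nhds
        (tendsto_binLaw_heavyBins ν hκ) (Or.inl (measure_ne_top κ univ)))
      (Or.inr ENNReal.one_ne_top)
  filter_upwards [hlim.eventually_const_lt ha] with M hM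
  refine hM.trans_le ?_
  rw [← binLaw_univ κ M, ← measure_compl .of_discrete (measure_ne_top _ _),
    ← ENNReal.mul_div_right_comm]
  refine ENNReal.div_le_div_right ((mul_le_mul_right (binLaw_mono hκν M _) _).trans ?_) _
  simpa only [heavyBins, compl_ofPred, not_le] using mul_measure_le_shannonEntropy (binLaw ν M) _

theorem eventually_shannonEntropy_div_log_lt {ν : Measure ℝ} [IsProbabilityMeasure ν]
    (hH : shannonEntropy (binLaw ν 1) ≠ ⊤) {S : Finset ℝ} {a : ℝ≥0∞} (ha : ν (↑S)ᶜ < a) :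
    ∀ᶠ M : ℕ in atTop, shannonEntropy (binLaw ν M) / ENNReal.ofReal (Real.log M) < a := by
  have hlog : Tendsto (fun M : ℕ => ENNReal.ofReal (Real.log M)) atTop (𝓝 ⊤) :=
    ENNReal.tendsto_ofReal_atTop.comp tendsto_log_natCast_atTop
  have hlim : Tendsto (fun M : ℕ => (S.card + (shannonEntropy (binLaw ν 1) + 1)) /
      ENNReal.ofReal (Real.log M) + ν (↑S)ᶜ) atTop (𝓝 (ν (↑S)ᶜ)) := by
    simpa only [ENNReal.div_top, zero_add] using (ENNReal.Tendsto.const_div hlog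
      (Or.inr (by finiteness))).add_const (ν (↑S)ᶜ)
  filter_upwards [hlim.eventually_lt_const ha, eventually_ne_atTop 0,
    tendsto_log_natCast_atTop.eventually_gt_atTop 0] with M hM hM0 hlogM
  refine (ENNReal.div_le_of_le_mul ?_).trans_lt hM
  have hsplit : binLaw ν M = binLaw (ν.restrict S) M + binLaw (ν.restrict (↑S)ᶜ) M := by
    rw [← binLaw_add, Measure.restrict_add_restrict_compl S.measurableSet]
  have hS : ν.restrict S (↑S)ᶜ = 0 := by
    rw [Measure.restrict_apply S.measurableSet.compl, compl_inter_self, measure_empty]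
  calc shannonEntropy (binLaw ν M)
      ≤ S.card + (ENNReal.ofReal (Real.log M) * ν.restrict (↑S)ᶜ univ +
          shannonEntropy (binLaw ν 1) + 1) := by
        rw [hsplit]
        exact (shannonEntropy_add_le _ _).trans (add_le_add (shannonEntropy_binLaw_le_card _ hS M)
          (shannonEntropy_binLaw_le Measure.restrict_le_self hM0))
    _ = _ := by
        rw [Measure.restrict_apply_univ, add_mul, ENNReal.div_mul_cancel
          (ENNReal.ofReal_pos.2 hlogM).ne' ENNReal.ofReal_ne_top]
        ring

theorem exists_finset_measure_compl_lt {α : Type*} [MeasurableSpace α]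
    [MeasurableSingletonClass α] {μ : Measure α} [IsFiniteMeasure μ] {D : Set α}
    (hD : D.Countable) {a : ℝ≥0∞} (ha : μ Dᶜ < a) : ∃ S : Finset α, μ (↑S)ᶜ < a := by
  have : Countable D := hD
  have hcompl : Dᶜ = ⋂ S : Finset D, ((↑) '' (S : Set D) : Set α)ᶜ := by
    rw [← compl_iUnion, iUnion_finset_eq_set]
  rw [hcompl, Directed.measure_iInter] at ha
  · obtain ⟨S, hS⟩ := iInf_lt_iff.1 ha
    exact ⟨S.map (Function.Embedding.subtype _), by rwa [Finset.coe_map]⟩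
  · exact fun S => (S.countable_toSet.image _).measurableSet.compl.nullMeasurableSet
  · exact Antitone.directed_ge fun S T hST => compl_subset_compl.2 (image_mono hST)
  · exact ⟨∅, measure_ne_top _ _⟩

-- Rényi's theorem: nearly all of the mass of `D` sits on finitely many points, which contribute a
-- bounded amount of entropy.
theorem hasInformationDimension_of_countable {ν : Measure ℝ} [IsProbabilityMeasure ν] {D : Set ℝ}
    (hD : D.Countable) (hν : ν.restrict Dᶜ ≪ volume) (hH : shannonEntropy (binLaw ν 1) ≠ ⊤) :
    HasInformationDimension ν (ν Dᶜ) := by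
  have hlim : Tendsto (fun M : ℕ => shannonEntropy (binLaw ν M) / ENNReal.ofReal (Real.log M))
      atTop (𝓝 (ν Dᶜ)) := by
    refine tendsto_order.2 ⟨fun a ha => ?_, fun a ha => ?_⟩
    · rw [← Measure.restrict_apply_univ] at ha
      exact eventually_lt_shannonEntropy_div_log Measure.restrict_le_self hν ha
    · obtain ⟨S, hS⟩ := exists_finset_measure_compl_lt hD ha
      exact eventually_shannonEntropy_div_log_lt hH hS
  refine hlim.congr' ?_
  filter_upwards [eventually_ne_atTop 0] with M hM
  rw [shannonEntropy_map_quantize ν hM]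

/-! ### Absolute continuity away from the critical points -/

theorem measure_eq_zero_of_measure_image_eq_zero {E : Type*} [NormedAddCommGroup E]
    [NormedSpace ℝ E] [FiniteDimensional ℝ E] [MeasurableSpace E] [BorelSpace E] (μ : Measure E)
    [μ.IsAddHaarMeasure] {f : E → E} {f' : E → E →L[ℝ] E} {s : Set E}
    (hf' : ∀ x ∈ s, HasFDerivWithinAt f (f' x) s x) (hdet : ∀ x ∈ s, (f' x).det ≠ 0)
    (hs : μ (f '' s) = 0) : μ s = 0 := by
  have hexp : ∀ A : E →L[ℝ] E, ∃ r : NNReal, r ≠ 0 ∧ (A.det ≠ 0 →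
      ∀ t, ApproximatesLinearOn f A t r → μ (f '' t) = 0 → μ t = 0) := fun A => by
    by_cases hA : A.det = 0
    · exact ⟨1, one_ne_zero, fun hA' => absurd hA hA'⟩
    obtain ⟨m, hm, hmA⟩ := ENNReal.lt_iff_exists_nnreal_btwn.1
      (ENNReal.ofReal_pos.2 (abs_pos.2 hA))
    obtain ⟨r, hr, hr0⟩ := ((mul_le_addHaar_image_of_lt_det μ A hmA).and
      self_mem_nhdsWithin).exists
    refine ⟨r, ne_of_gt (mem_Ioi.1 hr0), fun _ t ht ht0 => ?_⟩
    have hmul : (m : ℝ≥0∞) * μ t = 0 := le_zero_iff.1 ((hr t f ht).trans_eq ht0)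
    exact (mul_eq_zero.1 hmul).resolve_left hm.ne'
  choose r hr0 hr using hexp
  obtain ⟨t, A, -, -, hcover, happrox, hA⟩ :=
    exists_partition_approximatesLinearOn_of_hasFDerivWithinAt f s f' hf' r hr0
  rcases s.eq_empty_or_nonempty with rfl | hne
  · exact measure_empty
  rw [← inter_eq_left.2 hcover, inter_iUnion]
  refine measure_iUnion_null fun n => ?_
  obtain ⟨y, hy, hAy⟩ := hA hne n
  exact hr (A n) (hAy ▸ hdet y hy) _ (happrox n)
    (measure_mono_null (image_mono inter_subset_left) hs)

section FlatSet

variable {f : ℝ → ℝ} (hf : Measurable f) (hcrit : CriticalOnlyOnFlat f) {μ : Measure ℝ}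
  (hμ : μ ≪ volume)

include hf hcrit hμ

theorem absolutelyContinuous_map_restrict_flatSet_compl :
    (μ.restrict (flatSet f)ᶜ).map f ≪ volume := by
  refine Measure.AbsolutelyContinuous.mk fun A hA hA0 => ?_
  rw [Measure.map_apply hf hA, Measure.restrict_apply (hf hA)]
  refine hμ ?_
  set s := f ⁻¹' A ∩ {x | deriv f x ≠ 0}
  have hs : volume s = 0 := by
    refine measure_eq_zero_of_measure_image_eq_zero volume (fun x hx =>
      (differentiableAt_of_deriv_ne_zero hx.2).hasFDerivAt.hasFDerivWithinAt) (fun x hx => ?_)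
      (measure_mono_null (image_subset_iff.2 inter_subset_left) hA0)
    rw [ContinuousLinearMap.det, LinearMap.det_ring]
    exact hx.2
  refine measure_mono_null_ae ?_ hs
  filter_upwards [hcrit] with x hx hxA
  exact ⟨hxA.1, fun hderiv => hxA.2 (hx hderiv)⟩

theorem hasInformationDimension_map [IsProbabilityMeasure μ]
    (hH : shannonEntropy (μ.map fun z => ⌊f z⌋) ≠ ⊤) :
    HasInformationDimension (μ.map f) (μ (flatSet f)ᶜ) := by
  have hprob : IsProbabilityMeasure (μ.map f) := Measure.isProbabilityMeasure_map hf.aemeasurable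
  have hac := absolutelyContinuous_map_restrict_flatSet_compl hf hcrit hμ
  set D := f '' flatSet f
  have hDc : D.Countable := countable_image_flatSet f
  have hsub : f ⁻¹' Dᶜ ⊆ (flatSet f)ᶜ := fun x hx hflat => hx (mem_image_of_mem f hflat)
  have hnull : μ ((flatSet f)ᶜ \ f ⁻¹' Dᶜ) = 0 := by
    have hmap := hac (hDc.measure_zero volume)
    rwa [Measure.map_apply hf hDc.measurableSet, Measure.restrict_apply (hf hDc.measurableSet),
      inter_comm, ← compl_compl (f ⁻¹' D), ← sdiff_eq] at hmap
  have hmass : μ (flatSet f)ᶜ = μ.map f Dᶜ := by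
    rw [Measure.map_apply hf hDc.measurableSet.compl]
    exact measure_eq_measure_of_null_sdiff hsub hnull |>.symm
  rw [hmass]
  refine hasInformationDimension_of_countable hDc ?_ (shannonEntropy_map_floor μ hf ▸ hH)
  rw [Measure.restrict_map hf hDc.measurableSet.compl]
  exact (Measure.map_mono (Measure.restrict_mono hsub le_rfl) hf).absolutelyContinuous.trans hac

end FlatSet

theorem PiecewiseSmooth.measurable {f : ℝ → ℝ} (hf : PiecewiseSmooth f) : Measurable f := by
  obtain ⟨K, I, hI, -, hcover, hsmooth⟩ := hf
  refine measurable_of_isOpen fun t ht => ?_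
  rw [← inter_univ (f ⁻¹' t), ← hcover, inter_iUnion]
  refine MeasurableSet.iUnion fun i => ?_
  obtain ⟨u, hu, heq⟩ := continuousOn_iff'.1 (hsmooth i).1.continuousOn t ht
  exact heq ▸ hu.measurableSet.inter (hI i).measurableSet

end GLMEP

theorem mainTheorem7_general
    {f : ℝ → ℝ} (hf : Measurable f)
    {Pl : Measure ℝ} [IsProbabilityMeasure Pl] (hpos : ∀ᵐ l ∂Pl, 0 < l)
    {δ : ℝ} (hδ : 1 < δ) (hmean : ∫ l, l ∂Pl = δ)
    {Vl : ℕ → ℝ≥0∞} {Vr : ℕ → ℝ} (hSE : GLMEP.IsStateEvolution f Pl δ Vl Vr) :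
    Tendsto (fun t => GLMEP.mse Pl (Vl t)) atTop (𝓝 (GLMEP.finalMSE f Pl δ)) ∧
    (GLMEP.finalMSE f Pl δ = 0 ↔ ∀ v ∈ Set.Ioc (0 : ℝ) 1, 0 < GLMEP.PFun f Pl δ v) ∧
    (GLMEP.CriticalOnlyOnFlat f →
      GLMEP.shannonEntropy ((gaussianReal 0 1).map (fun z => ⌊f z⌋)) ≠ ⊤ →
      GLMEP.HasInformationDimension ((gaussianReal 0 1).map f)
        (gaussianReal 0 1 (GLMEP.flatSet f)ᶜ)) ∧
    ((∀ v ∈ Set.Ioc (0 : ℝ) 1, 0 < GLMEP.PFun f Pl δ v) →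
      (gaussianReal 0 1 (GLMEP.flatSet f)ᶜ)⁻¹ ≤ ENNReal.ofReal δ) :=
  ⟨GLMEP.tendsto_mse_finalMSE hf hpos hmean hδ hSE,
    GLMEP.finalMSE_eq_zero_iff hf hpos hmean hδ,
    fun hcrit => GLMEP.hasInformationDimension_map hf hcrit
      (gaussianReal_absolutelyContinuous 0 one_ne_zero),
    GLMEP.inv_measure_flatSet_compl_le hf hpos hmean hδ⟩

theorem mainTheorem7
    (f : ℝ → ℝ) (hf : GLMEP.PiecewiseSmooth f)
    (hH : GLMEP.shannonEntropy ((gaussianReal 0 1).map (fun z => ⌊f z⌋)) ≠ ⊤)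
    (Pl : Measure ℝ) [IsProbabilityMeasure Pl]
    (a b δ : ℝ) (ha : 0 < a) (hsupp : ∀ᵐ l ∂Pl, l ∈ Set.Icc a b)
    (hδ : 1 < δ) (hmean : ∫ l, l ∂Pl = δ)
    (Vl : ℕ → ℝ≥0∞) (Vr : ℕ → ℝ) (hSE : GLMEP.IsStateEvolution f Pl δ Vl Vr) :
    Tendsto (fun t => GLMEP.mse Pl (Vl t)) atTop (𝓝 (GLMEP.finalMSE f Pl δ)) ∧
    (GLMEP.finalMSE f Pl δ = 0 ↔ ∀ v ∈ Set.Ioc (0 : ℝ) 1, 0 < GLMEP.PFun f Pl δ v) ∧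
    (GLMEP.CriticalOnlyOnFlat f →
      ∃ d : ℝ≥0∞, GLMEP.HasInformationDimension ((gaussianReal 0 1).map f) d ∧
        ((∀ v ∈ Set.Ioc (0 : ℝ) 1, 0 < GLMEP.PFun f Pl δ v) → d⁻¹ ≤ ENNReal.ofReal δ)) := by
  obtain ⟨hlim, hzero, hdim, hle⟩ := mainTheorem7_general hf.measurable
    (hsupp.mono fun _ hl => ha.trans_le hl.1) hδ hmean hSE
  exact ⟨hlim, hzero, fun hcrit => ⟨_, hdim hcrit hH, hle⟩⟩
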